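/- **Setting.** Let $\mathcal A$ be a nonempty finite set of actions and $\mathcal Y$ a standard Borel space of outcomes (in particular, a Euclidean space or a compact subset of one). Let $\nu$ be a measure on $\mathcal Y$. For each $a\in\mathcal A$ the true outcome distribution $Q^*(\cdot|a)$ is a probability measure with a positive density $q^*(\cdot|a)$ with respect to $\nu$. The flow payoff is $u:\mathcal A\times\mathcal Y\to\mathbb R$ with $u(a,\cdot)\in L^1(Q^*(\cdot|a))$ for all $a$, the discount factor is $\delta\in[0,1)$, and the switching threshold is $\alpha>1$. A *subjective model* $\theta$ consists of a nonempty finite parameter set $\Omega^\theta$ in a Euclidean space and probability measures $Q^\theta(\cdot|a,\omega)$ with positive densities $q^\theta(\cdot|a,\omega)$ with respect to $\nu$, such that for all $a,\omega$: $u(a,\cdot)\in L^1(Q^\theta(\cdot|a,\omega))$, and there is $g\in L^2(Q^*(\cdot|a))$ with $|\ln (q^*(\cdot|a)/q^\theta(\cdot|a,\omega))|\le g$, $Q^*(\cdot|a)$-almost surely. Let $\Theta$ be the class of all subjective models. For a belief $\pi\in\Delta\Omega^\theta$ let $B^\theta(a,y,\pi)$ be its Bayesian update after action $a$ and outcome $y$.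 Let $U^\theta$ be the bounded measurable solution of $$U^\theta(\pi)=\max_{a\in\mathcal A}\sum_{\omega}\pi(\omega)\int\big[u(a,y)+\delta\,U^\theta(B^\theta(a,y,\pi))\big]\,q^\theta(y|a,\omega)\,\nu(dy).$$ An *optimal policy* is a measurable map $a^\theta:\Delta\Omega^\theta\to\mathcal A$ that selects a maximizer at every $\pi$. Let $A^\theta_m(\pi)$ be the set of maximizers for $\delta=0$ (the myopically optimal actions). Whenever action $a$ is taken in period $t$, the outcome $y_t$ is drawn from $Q^*(\cdot|a)$, independently across periods. A *dogmatic modeler* with model $\theta$, prior $\pi_0^\theta$ and policy $a^\theta$ plays $a_t=a^\theta(\pi_t^\theta)$, where $\pi^\theta_t$ is the posterior given the history. A *switcher* with initial model $\theta$ and competing model $\theta^c$, with priors $\pi_0^\theta,\pi_0^{\theta^c}$ and policies $a^\theta,a^{\theta^c}$, starts with $m_0=\theta$. In each period $t\ge1$ she changes from $m_{t-1}$ to the other model $m'$ if $l_t^{m'}/l_t^{m_{t-1}}>\alpha$ and keeps $m_t=m_{t-1}$ otherwise, where $l_t^{\vartheta}=\sum_{\omega\in\Omega^{\vartheta}}\pi_0^{\vartheta}(\omega)\prod_{\tau<t}q^{\vartheta}(y_\tau|a_\tau,\omega)$.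 In period $t$ she plays $a^{m_t}(\pi_t^{m_t})$. The model $\theta$ *persists* against $\theta^c$ (at these priors and policies) if with positive probability $m_t=\theta$ for all large $t$. The model $\theta$ is *globally robust* if there are a full-support prior $\pi_0^\theta$ and an optimal policy $a^\theta$ under which $\theta$ persists against every $\theta^c\in\Theta$ at every full-support prior $\pi_0^{\theta^c}$ and every optimal policy $a^{\theta^c}$. For $\sigma\in\Delta\mathcal A$ let $\Omega^\theta(\sigma)$ be the set of minimizers over $\omega\in\Omega^\theta$ of $\sum_a\sigma(a)D_{KL}(q^*(\cdot|a)\,\|\,q^\theta(\cdot|a,\omega))$. The strategy $\sigma$ is a *Berk-Nash equilibrium* under $\theta$ if $\operatorname{supp}\sigma\subseteq A^\theta_m(\pi)$ for some belief $\pi$ supported in $\Omega^\theta(\sigma)$. It is a *self-confirming equilibrium* if $\pi$ can moreover be chosen with $q^\theta(\cdot|a,\omega)=q^*(\cdot|a)$ ($\nu$-a.e.) for all $\omega\in\operatorname{supp}\pi$ and $a\in\operatorname{supp}\sigma$. A Berk-Nash equilibrium $\sigma$ is *p-absorbing* if, for some full-support prior and some optimal policy, there is $T\ge0$ such that with positive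 probability the dogmatic modeler with model $\theta$ plays only actions in $\operatorname{supp}\sigma$ from period $T$ on. **Theorem.** A model $\theta\in\Theta$ is globally robust if and only if there exists a p-absorbing self-confirming equilibrium under $\theta$. Moreover, if such an equilibrium exists, then there are a full-support prior and an optimal policy for $\theta$ under which, against every $\theta^c\in\Theta$ with any full-support prior and any optimal policy, with positive probability the switcher never switches ($m_t=\theta$ for all $t\ge0$). -/

import Mathlib

open MeasureTheory

noncomputable section

namespace ModelSwitching

variable {A Y : Type*} [MeasurableSpace Y]

/-- The objective environment: a common dominating measure `ν`, for each action `a` the density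
`q a` of the true outcome distribution, the flow payoff `u` and the discount factor `δ`.
Densities are represented by everywhere positive versions. -/
structure Environment (A Y : Type*) [MeasurableSpace Y] where
  ν : Measure Y
  q : A → Y → ℝ
  measurable_q : ∀ a, Measurable (q a)
  q_pos : ∀ a y, 0 < q a y
  lintegral_q : ∀ a, ∫⁻ y, ENNReal.ofReal (q a y) ∂ν = 1
  u : A → Y → ℝ
  integrable_u : ∀ a, Integrable (u a) (ν.withDensity fun y => ENNReal.ofReal (q a y))
  δ : ℝ
  δ_nonneg : 0 ≤ δ
  δ_lt_one : δ < 1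

namespace Environment

/-- The true outcome distribution `Q*(· | a)`. -/
def Q (E : Environment A Y) (a : A) : Measure Y :=
  E.ν.withDensity fun y => ENNReal.ofReal (E.q a y)

instance (E : Environment A Y) (a : A) : IsProbabilityMeasure (E.Q a) := by
  refine ⟨?_⟩
  rw [Q, withDensity_apply _ MeasurableSet.univ, Measure.restrict_univ]
  exact E.lintegral_q a

/-- The underlying probability measure: a sample point `s` lists, for every action `a` and every
period `t`, the outcome `s (a, t)` that is observed if `a` is taken in period `t`; all these
outcomes are independent, and `s (a, t)` has law `Q*(· | a)`. -/
def P (E : Environment A Y) : Measure (A × ℕ → Y) :=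
  Measure.infinitePi fun i : A × ℕ => E.Q i.1

end Environment

/-- A subjective model: a nonempty finite parameter set in a Euclidean space and, for each action
and each parameter, a positive outcome density. Payoffs are integrable under each of these
distributions, and the log-likelihood ratio to the truth is dominated by a square-integrable
function. The type of all such models is the class `Θ`. -/
structure SubjectiveModel (E : Environment A Y) where
  dim : ℕ
  Ω : Finset (EuclideanSpace ℝ (Fin dim))
  Ω_nonempty : Ω.Nonempty
  q : A → Ω → Y → ℝ
  measurable_q : ∀ a ω, Measurable (q a ω)
  q_pos : ∀ a ω y, 0 < q a ω y
  lintegral_q : ∀ a ω, ∫⁻ y, ENNReal.ofReal (q a ω y) ∂E.ν = 1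
  integrable_u : ∀ a ω,
    Integrable (E.u a) (E.ν.withDensity fun y => ENNReal.ofReal (q a ω y))
  dominated : ∀ a ω, ∃ g : Y → ℝ, MemLp g 2 (E.Q a) ∧
    ∀ᵐ y ∂E.Q a, |Real.log (E.q a y / q a ω y)| ≤ g y

/-- The initial model and the competing model of a switcher. -/
inductive Slot where
  | initial : Slot
  | competing : Slot

/-- The support of a mixed action. -/
def supp [Fintype A] (σ : stdSimplex ℝ A) : Set A := {a | 0 < σ.1 a}

/-- Finite histories, most recent period first. -/
abbrev History (A Y : Type*) := List (A × Y)

namespace SubjectiveModel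

variable {E : Environment A Y}

/-- Beliefs over the parameters of a model. -/
abbrev Belief (θ : SubjectiveModel E) : Type := stdSimplex ℝ θ.Ω

/-- The outcome distribution `Q^θ(· | a, ω)`. -/
def Q (θ : SubjectiveModel E) (a : A) (ω : θ.Ω) : Measure Y :=
  E.ν.withDensity fun y => ENNReal.ofReal (θ.q a ω y)

theorem predictive_pos (θ : SubjectiveModel E) (a : A) (y : Y) (π : θ.Belief) :
    0 < ∑ ω, π.1 ω * θ.q a ω y := by
  have h0 : ∀ ω ∈ Finset.univ, 0 ≤ π.1 ω * θ.q a ω y := fun ω _ =>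
    mul_nonneg (π.2.1 ω) (θ.q_pos a ω y).le
  refine lt_of_le_of_ne (Finset.sum_nonneg h0) fun h => ?_
  have hz := (Finset.sum_eq_zero_iff_of_nonneg h0).1 h.symm
  have h1 : ∑ ω, π.1 ω = 0 := Finset.sum_eq_zero fun ω hω =>
    (mul_eq_zero.1 (hz ω hω)).resolve_right (θ.q_pos a ω y).ne'
  exact one_ne_zero (π.2.2.symm.trans h1)

/-- The Bayesian operator `B^θ(a, y, π)`. -/
def bayes (θ : SubjectiveModel E) (a : A) (y : Y) (π : θ.Belief) : θ.Belief :=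
  ⟨fun ω => π.1 ω * θ.q a ω y / ∑ ω', π.1 ω' * θ.q a ω' y,
    fun ω => div_nonneg (mul_nonneg (π.2.1 ω) (θ.q_pos a ω y).le) (θ.predictive_pos a y π).le,
    by rw [← Finset.sum_div]; exact div_self (θ.predictive_pos a y π).ne'⟩

/-- A belief (or prior) with full support. -/
def FullSupport (θ : SubjectiveModel E) (π : θ.Belief) : Prop := ∀ ω, 0 < π.1 ω

/-- The posterior belief after a history, starting from the prior `π₀`. -/
def posterior (θ : SubjectiveModel E) (π₀ : θ.Belief) : History A Y → θ.Belief
  | [] => π₀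
  | (a, y) :: h => θ.bayes a y (posterior θ π₀ h)

/-- The likelihood `l_t^θ` of a history, evaluated at the prior `π₀`. -/
def likelihood (θ : SubjectiveModel E) (π₀ : θ.Belief) (h : History A Y) : ℝ :=
  ∑ ω, π₀.1 ω * (h.map fun p => θ.q p.1 ω p.2).prod

/-- Expected value of taking `a` at belief `π` when the discount factor is `d` and the
continuation value is `U`. -/
def actionValue (θ : SubjectiveModel E) (d : ℝ) (U : θ.Belief → ℝ) (π : θ.Belief) (a : A) : ℝ :=
  ∑ ω, π.1 ω * ∫ y, (E.u a y + d * U (θ.bayes a y π)) ∂θ.Q a ω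

/-- `U` is the value function of the dynamic programming problem under `θ`: the bounded measurable
solution of the Bellman equation (the maximum of the action values equals `U π`). -/
def IsValueFunction (θ : SubjectiveModel E) (U : θ.Belief → ℝ) : Prop :=
  Measurable U ∧ (∃ C, ∀ π, |U π| ≤ C) ∧
    ∀ π, IsGreatest (Set.range fun a => θ.actionValue E.δ U π a) (U π)

/-- `pol` is a (measurable, pure) optimal policy: at each belief it picks an action that attains
the maximum in the Bellman equation. -/
def IsOptimalPolicy (θ : SubjectiveModel E) (pol : θ.Belief → A) : Prop :=
  (∀ a, MeasurableSet (pol ⁻¹' {a})) ∧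
    ∃ U, θ.IsValueFunction U ∧
      ∀ π a, θ.actionValue E.δ U π a ≤ θ.actionValue E.δ U π (pol π)

/-- The set of myopically optimal actions `A_m^θ(π)` (discount factor zero). -/
def myopicOptimal (θ : SubjectiveModel E) (π : θ.Belief) : Set A :=
  {a | ∀ b, θ.actionValue 0 0 π b ≤ θ.actionValue 0 0 π a}

/-- The `σ`-weighted Kullback-Leibler divergence of the truth from the prediction at `ω`. -/
def weightedKL [Fintype A] (θ : SubjectiveModel E) (σ : stdSimplex ℝ A) (ω : θ.Ω) : ENNReal :=
  ∑ a, ENNReal.ofReal (σ.1 a) * InformationTheory.klDiv (E.Q a) (θ.Q a ω)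

/-- The Kullback-Leibler minimizers `Ω^θ(σ)`. -/
def klMinimizers [Fintype A] (θ : SubjectiveModel E) (σ : stdSimplex ℝ A) : Set θ.Ω :=
  {ω | ∀ ω', θ.weightedKL σ ω ≤ θ.weightedKL σ ω'}

/-- `σ` is a Berk-Nash equilibrium under `θ`. -/
def IsBerkNash [Fintype A] (θ : SubjectiveModel E) (σ : stdSimplex ℝ A) : Prop :=
  ∃ π : θ.Belief, (∀ ω, 0 < π.1 ω → ω ∈ θ.klMinimizers σ) ∧ supp σ ⊆ θ.myopicOptimal π

/-- `σ` is a self-confirming equilibrium under `θ`. -/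
def IsSelfConfirming [Fintype A] (θ : SubjectiveModel E) (σ : stdSimplex ℝ A) : Prop :=
  θ.IsBerkNash σ ∧
    ∃ π : θ.Belief, (∀ ω, 0 < π.1 ω → ω ∈ θ.klMinimizers σ) ∧ supp σ ⊆ θ.myopicOptimal π ∧
      ∀ ω, 0 < π.1 ω → ∀ a ∈ supp σ, E.q a =ᵐ[E.ν] θ.q a ω

end SubjectiveModel

/-- The history at the beginning of period `t` when actions are chosen by the rule `f` (a function
of the observable history) and the sample point is `s`. -/
def historyOf (f : History A Y → A) (s : A × ℕ → Y) : ℕ → History A Y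
  | 0 => []
  | t + 1 => (f (historyOf f s t), s (f (historyOf f s t), t)) :: historyOf f s t

namespace SubjectiveModel

variable {E : Environment A Y}

/-- The behavior of the dogmatic modeler with model `θ`, prior `π₀` and policy `pol`. -/
def dogmatic (θ : SubjectiveModel E) (π₀ : θ.Belief) (pol : θ.Belief → A) (h : History A Y) : A :=
  pol (θ.posterior π₀ h)

/-- `σ` is absorbing with positive probability under `θ`. -/
def IsPAbsorbing [Fintype A] (θ : SubjectiveModel E) (σ : stdSimplex ℝ A) : Prop :=
  θ.IsBerkNash σ ∧
    ∃ (π₀ : θ.Belief) (pol : θ.Belief → A), θ.FullSupport π₀ ∧ θ.IsOptimalPolicy pol ∧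
      ∃ T : ℕ, 0 < E.P {s | ∀ t ≥ T,
        θ.dogmatic π₀ pol (historyOf (θ.dogmatic π₀ pol) s t) ∈ supp σ}

/-- The model choice `m_t` of a switcher after a history. The Bayes factor of the model adopted in
the last period is `1 < α`, so a switch occurs exactly when the Bayes factor of the other model
exceeds `α`. -/
def modelChoice (α : ℝ) (θ θc : SubjectiveModel E) (π₀ : θ.Belief) (πc : θc.Belief) :
    History A Y → Slot
  | [] => Slot.initial
  | p :: h =>
    match modelChoice α θ θc π₀ πc h with
    | Slot.initial =>
      if α < θc.likelihood πc (p :: h) / θ.likelihood π₀ (p :: h) then Slot.competing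
      else Slot.initial
    | Slot.competing =>
      if α < θ.likelihood π₀ (p :: h) / θc.likelihood πc (p :: h) then Slot.initial
      else Slot.competing

/-- The behavior of the switcher: the policy of the current model is applied to the posterior of
the current model. -/
def switcher (α : ℝ) (θ θc : SubjectiveModel E) (π₀ : θ.Belief) (πc : θc.Belief)
    (pol : θ.Belief → A) (polc : θc.Belief → A) (h : History A Y) : A :=
  match modelChoice α θ θc π₀ πc h with
  | Slot.initial => pol (θ.posterior π₀ h)
  | Slot.competing => polc (θc.posterior πc h)

/-- The realized model choice of the switcher in period `t` at the sample point `s`. -/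
def modelPath (α : ℝ) (θ θc : SubjectiveModel E) (π₀ : θ.Belief) (πc : θc.Belief)
    (pol : θ.Belief → A) (polc : θc.Belief → A) (s : A × ℕ → Y) (t : ℕ) : Slot :=
  modelChoice α θ θc π₀ πc (historyOf (switcher α θ θc π₀ πc pol polc) s t)

/-- `θ` persists against `θc`: with positive probability `m_t` converges to `θ`, that is, equals
`θ` from some period on. -/
def PersistsAgainst (α : ℝ) (θ θc : SubjectiveModel E) (π₀ : θ.Belief) (πc : θc.Belief)
    (pol : θ.Belief → A) (polc : θc.Belief → A) : Prop :=
  0 < E.P {s | ∃ T : ℕ, ∀ t ≥ T, modelPath α θ θc π₀ πc pol polc s t = Slot.initial}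

/-- With positive probability the switcher never abandons `θ` for `θc`. -/
def NeverSwitches (α : ℝ) (θ θc : SubjectiveModel E) (π₀ : θ.Belief) (πc : θc.Belief)
    (pol : θ.Belief → A) (polc : θc.Belief → A) : Prop :=
  0 < E.P {s | ∀ t : ℕ, modelPath α θ θc π₀ πc pol polc s t = Slot.initial}

/-- `θ` is globally robust at the switching threshold `α`. -/
def IsGloballyRobust (α : ℝ) (θ : SubjectiveModel E) : Prop :=
  ∃ (π₀ : θ.Belief) (pol : θ.Belief → A), θ.FullSupport π₀ ∧ θ.IsOptimalPolicy pol ∧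
    ∀ (θc : SubjectiveModel E) (πc : θc.Belief) (polc : θc.Belief → A),
      θc.FullSupport πc → θc.IsOptimalPolicy polc → PersistsAgainst α θ θc π₀ πc pol polc

end SubjectiveModel

end ModelSwitching

end

/-! Likelihoods are measured relative to the truth: `relLikelihood` averages, over the prior, the
products of the ratios of model density to true density. Along any measurable rule it is a
nonnegative martingale started at 1, and Bayes factors between models are quotients of such
processes. Both directions pass through `LikelihoodSurvives`.

If a self-confirming equilibrium absorbs play, a parameter in the support of its belief has ratio
one on the actions still used, so its term is frozen and the likelihood survives
(`IsSelfConfirming.likelihoodSurvives`). By martingale convergence and Lévy's upward theorem, some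
late history has a posterior from which the likelihood stays above a constant `β` near 1 with
probability above `β`. Taking this posterior as prior, Ville's inequality bounds the competitor's
likelihood with enough probability left over, uniformly over competitors
(`LikelihoodSurvives.exists_neverSwitches`).

Conversely, let the competitor be the true model, whose relative likelihood is identically 1.
Persistence against it keeps the likelihood of `θ` bounded below
(`PersistsAgainst.likelihoodSurvives`). Then the posterior converges, and a parameter that is wrong
about an action played infinitely often has weight zero in the limit (`ae_tendsto_pathProd_zero`).
The recurring actions are thus uninformative at the limit belief, and by continuity of the value
function dynamically optimal there, hence myopically optimal. Since finitely many sets of recurring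
actions are possible, one has positive probability and supports the equilibrium
(`LikelihoodSurvives.exists_equilibrium`). -/

noncomputable section

namespace ModelSwitching

open Filter Topology ProbabilityTheory

/-! ### Histories along sample points, restarts and measurability -/

section Paths

variable {A Y β : Type*}

theorem length_historyOf (f : History A Y → A) (s : A × ℕ → Y) (t : ℕ) :
    (historyOf f s t).length = t := by
  induction t with
  | zero => rfl
  | succ t ih => simp [historyOf, ih]

theorem historyOf_congr (f : History A Y → A) {s s' : A × ℕ → Y} {t : ℕ}
    (h : ∀ i : A × ℕ, i.2 < t → s i = s' i) : historyOf f s t = historyOf f s' t := by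
  induction t with
  | zero => rfl
  | succ t ih =>
    simp only [historyOf]
    rw [ih fun i hi => h i (by omega), h (_, t) (by simp)]

/-- The sample point that follows `s` before period `T` and restarts with `s'` at `T`. -/
def splice (T : ℕ) (s s' : A × ℕ → Y) : A × ℕ → Y :=
  fun i => if i.2 < T then s i else s' (i.1, i.2 - T)

theorem historyOf_splice_self (f : History A Y → A) (T : ℕ) (s s' : A × ℕ → Y) :
    historyOf f (splice T s s') T = historyOf f s T :=
  historyOf_congr f fun i hi => by simp [splice, hi]

/-- The restart principle: what follows period `T` is a fresh run of the rule with the old history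
attached at the tail, the tail being the distant past. -/
theorem historyOf_splice (f : History A Y → A) (T : ℕ) (s s' : A × ℕ → Y) (t : ℕ) :
    historyOf f (splice T s s') (T + t) =
      historyOf (fun h => f (h ++ historyOf f s T)) s' t ++ historyOf f s T := by
  induction t with
  | zero => simp [historyOf, historyOf_splice_self]
  | succ t ih =>
    rw [← add_assoc]
    simp only [historyOf]
    rw [ih]
    simp [splice]

/-- The history in which the actions are those of the list `w` and outcomes are read off `s`. -/
def playOut (s : A × ℕ → Y) : List A → History A Y
  | [] => []
  | a :: w => (a, s (a, w.length)) :: playOut s w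

/-- A history is recovered from its action list and the sample point. As there are countably many
action lists, measurability need only be checked with the actions held fixed. -/
theorem playOut_map_fst (f : History A Y → A) (s : A × ℕ → Y) (t : ℕ) :
    playOut s ((historyOf f s t).map Prod.fst) = historyOf f s t := by
  induction t with
  | zero => rfl
  | succ t ih => simp [historyOf, playOut, ih, length_historyOf]

variable [MeasurableSpace Y]

/-- Measurability of a function of histories in the outcomes, for every sequence of actions. -/
def HistoryMeasurable [MeasurableSpace β] (φ : History A Y → β) : Prop :=
  ∀ w : List A, Measurable fun s : A × ℕ → Y => φ (playOut s w)

/-- Measurability of a rule of behavior in the outcomes. -/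
def MeasurableRule (f : History A Y → A) : Prop :=
  ∀ (w : List A) (a : A), MeasurableSet {s : A × ℕ → Y | f (playOut s w) = a}

theorem measurableSet_actions_eq {f : History A Y → A} (hf : MeasurableRule f) (t : ℕ)
    (w : List A) : MeasurableSet {s : A × ℕ → Y | (historyOf f s t).map Prod.fst = w} := by
  induction t generalizing w with
  | zero => simp [historyOf]
  | succ t ih =>
    cases w with
    | nil => simp [historyOf]
    | cons a w =>
      have : {s : A × ℕ → Y | (historyOf f s (t + 1)).map Prod.fst = a :: w} =
          {s | (historyOf f s t).map Prod.fst = w} ∩ {s | f (playOut s w) = a} := by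
        ext s
        simp only [historyOf, List.map_cons, List.cons.injEq, Set.mem_ofPred_eq, Set.mem_inter_iff]
        constructor
        · rintro ⟨h1, rfl⟩; rw [playOut_map_fst]; exact ⟨rfl, h1⟩
        · rintro ⟨rfl, h2⟩; rw [playOut_map_fst] at h2; exact ⟨h2, rfl⟩
      rw [this]
      exact (ih w).inter (hf w a)

theorem HistoryMeasurable.comp_historyOf [Countable A] [MeasurableSpace β] {φ : History A Y → β}
    (hφ : HistoryMeasurable φ) {f : History A Y → A} (hf : MeasurableRule f) (t : ℕ) :
    Measurable fun s => φ (historyOf f s t) := by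
  intro B hB
  have : (fun s => φ (historyOf f s t)) ⁻¹' B =
      ⋃ w : List A, {s : A × ℕ → Y | (historyOf f s t).map Prod.fst = w} ∩
        (fun s => φ (playOut s w)) ⁻¹' B := by
    ext s
    simp only [Set.mem_preimage, Set.mem_iUnion, Set.mem_inter_iff, Set.mem_ofPred_eq]
    constructor
    · intro h; exact ⟨_, rfl, by rwa [playOut_map_fst]⟩
    · rintro ⟨w, rfl, h⟩; rwa [playOut_map_fst] at h
  rw [this]
  exact MeasurableSet.iUnion fun w => (measurableSet_actions_eq hf t w).inter (hφ w hB)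

theorem MeasurableRule.measurableSet_action_eq [Countable A] {f : History A Y → A}
    (hf : MeasurableRule f) (t : ℕ) (a : A) :
    MeasurableSet {s : A × ℕ → Y | f (historyOf f s t) = a} := by
  have h : HistoryMeasurable fun h : History A Y => (f h = a : Prop) := fun w =>
    measurableSet_setOfPred.1 (hf w a)
  exact measurableSet_setOfPred.2 (h.comp_historyOf hf t)

theorem measurable_splice (T : ℕ) :
    Measurable fun p : (A × ℕ → Y) × (A × ℕ → Y) => splice T p.1 p.2 := by
  refine measurable_pi_iff.2 fun i => ?_
  unfold splice
  split_ifs <;> fun_prop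

end Paths

/-! ### The product measure: restarting, past information, conditional probabilities -/

section Product

variable {A Y : Type*} [MeasurableSpace Y] (E : Environment A Y)

instance : IsProbabilityMeasure E.P := by unfold Environment.P; infer_instance

/-- Outcomes are independent and their law does not depend on the period, so an independent copy may
be glued in at `T` with its clock reset. -/
theorem map_splice (T : ℕ) :
    (E.P.prod E.P).map (fun p => splice T p.1 p.2) = E.P := by
  classical
  refine Measure.eq_infinitePi _ fun I B hB => ?_
  rw [Measure.map_apply (measurable_splice T) (MeasurableSet.pi I.countable_toSet fun i _ => hB i)]
  set I1 := I.filter fun i => i.2 < T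
  set I2 := (I.filter fun i => ¬ i.2 < T).image fun i => (i.1, i.2 - T)
  have hpre : (fun p : (A × ℕ → Y) × (A × ℕ → Y) => splice T p.1 p.2) ⁻¹' Set.pi I B =
      (Set.pi I1 B) ×ˢ (Set.pi I2 fun i => B (i.1, i.2 + T)) := by
    ext ⟨s, s'⟩
    simp only [Set.mem_preimage, Set.mem_pi, Set.mem_prod, Finset.mem_coe, I1, I2,
      Finset.mem_filter, Finset.mem_image, splice]
    constructor
    · intro h
      refine ⟨fun i hi => by simpa [hi.2] using h i hi.1, ?_⟩
      rintro _ ⟨i, hi, rfl⟩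
      have := h i hi.1
      simp only [hi.2, if_false] at this
      rwa [Nat.sub_add_cancel (not_lt.1 hi.2)]
    · rintro ⟨h1, h2⟩ i hi
      split_ifs with hT
      · exact h1 i ⟨hi, hT⟩
      · have := h2 _ ⟨i, ⟨hi, hT⟩, rfl⟩
        rwa [Nat.sub_add_cancel (not_lt.1 hT)] at this
  rw [hpre, Measure.prod_prod]
  unfold Environment.P
  rw [Measure.infinitePi_pi _ fun i _ => hB i,
    Measure.infinitePi_pi, Finset.prod_image,
    ← Finset.prod_filter_mul_prod_filter_not I (fun i => i.2 < T)]
  · congr 1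
    refine Finset.prod_congr rfl fun i hi => ?_
    simp only [Finset.mem_filter] at hi
    simp only [Nat.sub_add_cancel (not_lt.1 hi.2)]
  · intro i hi j hj h
    simp only [Finset.coe_filter, Set.mem_ofPred_eq, Prod.mk.injEq] at hi hj h
    exact Prod.ext h.1 (by omega)
  · simp only [I2, Finset.mem_image, Finset.mem_filter]
    rintro _ ⟨i, hi, rfl⟩
    simp only [Nat.sub_add_cancel (not_lt.1 hi.2)]
    exact hB i

/-- Fubini for the glued pair; the integrand serves as the conditional probability of `N` given the
outcomes before `T`. -/
theorem P_eq_lintegral_splice (T : ℕ) {N : Set (A × ℕ → Y)} (hN : MeasurableSet N) :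
    E.P N = ∫⁻ s, E.P (splice T s ⁻¹' N) ∂E.P := by
  conv_lhs => rw [← map_splice E T, Measure.map_apply (measurable_splice T) hN,
    Measure.prod_apply (measurable_splice T hN)]
  rfl

theorem exists_splice_pos (T : ℕ) {N : Set (A × ℕ → Y)} (hN : MeasurableSet N) (h : 0 < E.P N) :
    ∃ s, 0 < E.P (splice T s ⁻¹' N) := by
  by_contra! hcon
  rw [P_eq_lintegral_splice E T hN] at h
  simp [fun s => le_antisymm (hcon s) bot_le] at h

/-- The information generated by all outcomes before period `t`. -/
def pastFiltration (A Y : Type*) [MeasurableSpace Y] :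
    Filtration ℕ (MeasurableSpace.pi : MeasurableSpace (A × ℕ → Y)) where
  seq t := ⨆ i ∈ {i : A × ℕ | i.2 < t}, MeasurableSpace.comap (fun s => s i) inferInstance
  mono' _ _ htu := iSup₂_le fun i (hi : i.2 < _) =>
    le_iSup₂_of_le i (show i.2 < _ from hi.trans_le htu) le_rfl
  le' _ := iSup₂_le fun i _ => (measurable_pi_apply i).comap_le

theorem iSup_pastFiltration : ⨆ t, pastFiltration A Y t = MeasurableSpace.pi := by
  refine le_antisymm (iSup_le fun t => (pastFiltration A Y).le t) ?_
  refine iSup_le fun i => le_iSup_of_le (i.2 + 1) ?_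
  exact le_iSup₂_of_le (f := fun (i : A × ℕ) (_ : i ∈ {i : A × ℕ | i.2 < _}) =>
    MeasurableSpace.comap (fun s : A × ℕ → Y => s i) inferInstance) i
    (show i.2 < i.2 + 1 from Nat.lt_succ_self _) le_rfl

theorem indep_pastFiltration (a : A) (t : ℕ) :
    Indep (MeasurableSpace.comap (fun s : A × ℕ → Y => s (a, t)) inferInstance)
      (pastFiltration A Y t) E.P := by
  have h := indep_iSup_of_disjoint (μ := E.P)
    (m := fun i : A × ℕ => MeasurableSpace.comap (fun s : A × ℕ → Y => s i) inferInstance)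
    (fun i => (measurable_pi_apply i).comap_le)
    (iIndepFun_infinitePi (P := fun i : A × ℕ => E.Q i.1) (X := fun _ y => y)
      (fun _ => measurable_id))
    (S := {(a, t)}) (T := {i | i.2 < t}) (by simp)
  simpa [pastFiltration] using h

/-- A measurable function of the path that only depends on the past is adapted. -/
theorem measurable_pastFiltration [Nonempty Y] {β : Type*} [MeasurableSpace β]
    {X : (A × ℕ → Y) → β} (hX : Measurable X) {t : ℕ}
    (h : ∀ s s' : A × ℕ → Y, (∀ i, i.2 < t → s i = s' i) → X s = X s') :
    Measurable[pastFiltration A Y t] X := by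
  classical
  obtain ⟨y⟩ := ‹Nonempty Y›
  -- Freezing all later coordinates at a fixed outcome does not change `X` and factors it through
  -- the past.
  have h1 : X = X ∘ fun (s : A × ℕ → Y) i => if i.2 < t then s i else y :=
    funext fun s => h _ _ fun i hi => by simp [hi]
  rw [h1]
  refine hX.comp ?_
  refine @measurable_pi_iff _ _ _ (pastFiltration A Y t) _ _ |>.2 fun i => ?_
  split_ifs with hi
  · refine Measurable.mono (comap_measurable (fun s : A × ℕ → Y => s i)) ?_ le_rfl
    exact le_iSup₂_of_le (f := fun (i : A × ℕ) (_ : i ∈ {i : A × ℕ | i.2 < _}) =>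
      MeasurableSpace.comap (fun s : A × ℕ → Y => s i) inferInstance) i hi le_rfl
  · exact @measurable_const _ _ _ (pastFiltration A Y t) _

theorem mem_iff_of_pastFiltration {t : ℕ} {C : Set (A × ℕ → Y)}
    (hC : MeasurableSet[pastFiltration A Y t] C) {s s' : A × ℕ → Y}
    (h : ∀ i, i.2 < t → s i = s' i) : s ∈ C ↔ s' ∈ C := by
  have hle : pastFiltration A Y t ≤ MeasurableSpace.comap
      (fun (s : A × ℕ → Y) (i : {i : A × ℕ // i.2 < t}) => s i) MeasurableSpace.pi := by
    refine iSup₂_le fun i hi => ?_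
    rw [show (fun s : A × ℕ → Y => s i) = (fun z : {i : A × ℕ // i.2 < t} → Y => z ⟨i, hi⟩) ∘
      fun (s : A × ℕ → Y) (i : {i : A × ℕ // i.2 < t}) => s i from rfl,
      ← MeasurableSpace.comap_comp]
    exact MeasurableSpace.comap_mono (measurable_pi_apply _).comap_le
  obtain ⟨D, -, rfl⟩ := hle C hC
  simp only [Set.mem_preimage]
  rw [show (fun i : {i : A × ℕ // i.2 < t} => s i) = fun i : {i : A × ℕ // i.2 < t} => s' i from
    funext fun i => h i i.2]

/-- If `N` has positive probability, then along some path its conditional probability given the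
past becomes arbitrarily close to one, at some late period. -/
theorem exists_splice_gt (n : ℕ) {N : Set (A × ℕ → Y)} (hN : MeasurableSet N) (h : 0 < E.P N)
    {c : ℝ} (hc0 : 0 ≤ c) (hc : c < 1) :
    ∃ T ≥ n, ∃ s, ENNReal.ofReal c < E.P (splice T s ⁻¹' N) := by
  obtain ⟨d, hcd, hd1⟩ := exists_between hc
  set g : (A × ℕ → Y) → ℝ := N.indicator fun _ => 1
  have hgi : Integrable g E.P := (integrable_const (1 : ℝ)).indicator hN
  -- Lévy's upward theorem: conditional probabilities of `N` tend to 1 almost surely on `N`, so they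
  -- exceed `d` at some late period with positive probability.
  have hconv := hgi.tendsto_ae_condExp (ℱ := pastFiltration A Y) (by
    rw [iSup_pastFiltration]; exact (stronglyMeasurable_const.indicator hN))
  set C : ℕ → Set (A × ℕ → Y) := fun T => {s | d < (E.P[g | pastFiltration A Y T]) s}
  have hCm : ∀ T, MeasurableSet[pastFiltration A Y T] (C T) := fun T =>
    (stronglyMeasurable_condExp.measurable) measurableSet_Ioi
  obtain ⟨T, hT, hCT⟩ : ∃ T ≥ n, 0 < E.P (C T) := by
    by_contra! hcon
    have h0 : ∀ᵐ s ∂E.P, ∀ T ≥ n, s ∉ C T := by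
      rw [ae_all_iff]; intro T
      by_cases hT : T ≥ n
      · have := le_antisymm (hcon T hT) bot_le
        filter_upwards [measure_eq_zero_iff_ae_notMem.1 this] with s hs _ using hs
      · exact ae_of_all _ fun s hs => absurd hs hT
    have : ∀ᵐ s ∂E.P, s ∉ N := by
      filter_upwards [hconv, h0] with s hs hs' hsN
      have hg : g s = 1 := by simp [g, hsN]
      rw [hg] at hs
      obtain ⟨T, hT, hT'⟩ := ((hs.eventually (lt_mem_nhds hd1)).and (eventually_ge_atTop n)).exists
      exact hs' T hT' hT
    exact h.ne' (measure_eq_zero_iff_ae_notMem.2 this)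
  refine ⟨T, hT, ?_⟩
  -- If every glued probability were at most `c`, then on the past event `C T` one would get `d * P
  -- (C T) ≤ P (N ∩ C T) ≤ c * P (C T)`, against `c < d`.
  by_contra! hcon
  have hCm' := (pastFiltration A Y).le T _ (hCm T)
  have e1 : ENNReal.ofReal d * E.P (C T) ≤ E.P (N ∩ C T) := by
    have h1 : ∫ s in C T, g s ∂E.P = (E.P (N ∩ C T)).toReal := by
      rw [← integral_indicator hCm']
      simp only [g, Set.indicator_indicator]
      rw [Set.inter_comm, integral_indicator_const _ (hN.inter hCm')]
      simp [Measure.real]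
    have h2 := setIntegral_condExp ((pastFiltration A Y).le T) hgi (hCm T)
    have h3 : d * (E.P (C T)).toReal ≤ ∫ s in C T, (E.P[g | pastFiltration A Y T]) s ∂E.P := by
      have := setIntegral_ge_of_const_le_real hCm' (measure_ne_top _ _)
        (fun s (hs : s ∈ C T) => hs.le) integrable_condExp.integrableOn (c := d)
        (f := fun s => (E.P[g | pastFiltration A Y T]) s)
      simpa [Measure.real] using this
    rw [h2, h1] at h3
    rw [← ENNReal.ofReal_toReal (measure_ne_top E.P (N ∩ C T)),
      ← ENNReal.ofReal_toReal (measure_ne_top E.P (C T)), ← ENNReal.ofReal_mul (hc0.trans hcd.le)]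
    exact ENNReal.ofReal_le_ofReal h3
  have e2 : E.P (N ∩ C T) ≤ ENNReal.ofReal c * E.P (C T) := by
    rw [P_eq_lintegral_splice E T (hN.inter hCm'), ← setLIntegral_const,
      ← lintegral_indicator hCm']
    refine lintegral_mono fun s => ?_
    by_cases hs : s ∈ C T
    · simp only [hs, Set.indicator_of_mem]
      exact (measure_mono (Set.preimage_mono Set.inter_subset_left)).trans (hcon s)
    · have : splice T s ⁻¹' (N ∩ C T) = ∅ := by
        ext s'
        simp only [Set.mem_preimage, Set.mem_inter_iff, Set.mem_empty_iff_false, iff_false, not_and]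
        rintro - h'
        exact hs ((mem_iff_of_pastFiltration (hCm T) fun i hi => by simp [splice, hi]).1 h')
      simp [this]
  have e3 := e1.trans e2
  rw [ENNReal.mul_le_mul_iff_left hCT.ne' (measure_ne_top _ _),
    ENNReal.ofReal_le_ofReal_iff hc0] at e3
  linarith

end Product

/-! ### Martingale inequalities and products of mean-one factors -/

section Martingales

/-- Ville's maximal inequality. -/
theorem measure_exists_ge_le_inv {Ω : Type*} {m0 : MeasurableSpace Ω} {μ : Measure Ω}
    [IsProbabilityMeasure μ] {ℱ : Filtration ℕ m0} {X : ℕ → Ω → ℝ} (hX : Martingale X ℱ μ)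
    (hX0 : 0 ≤ X) (h1 : ∫ s, X 0 s ∂μ = 1) {c : ℝ} (hc : 0 < c) :
    μ {s | ∃ t, c ≤ X t s} ≤ ENNReal.ofReal c⁻¹ := by
  have hint : ∀ n, ∫ s, X n s ∂μ = 1 := fun n => by
    have := hX.setIntegral_eq (Nat.zero_le n) (s := Set.univ) MeasurableSet.univ
    simp only [setIntegral_univ] at this
    rw [← this, h1]
  have hset : {s | ∃ t, c ≤ X t s} = ⋃ n, {s | ∃ t ≤ n, c ≤ X t s} := by
    ext s
    simp only [Set.mem_iUnion, Set.mem_ofPred_eq]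
    exact ⟨fun ⟨t, h⟩ => ⟨t, t, le_rfl, h⟩, fun ⟨_, t, _, h⟩ => ⟨t, h⟩⟩
  have hmono : Monotone fun n => {s | ∃ t ≤ n, c ≤ X t s} :=
    fun m n hmn s ⟨t, ht, h⟩ => ⟨t, ht.trans hmn, h⟩
  rw [hset, hmono.measure_iUnion]
  refine iSup_le fun n => ?_
  -- Doob's maximal inequality on a finite horizon; the bound does not depend on `n`, so it passes
  -- to the increasing union.
  have hmax := maximal_ineq hX.submartingale hX0 (ε := NNReal.mk c hc.le) n
  have hle : ENNReal.ofReal c * μ {s | ∃ t ≤ n, c ≤ X t s} ≤ 1 := by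
    have e : ENNReal.ofReal c = ((NNReal.mk c hc.le : NNReal) : ENNReal) := by
      rw [ENNReal.ofReal, Real.toNNReal_of_nonneg hc.le]
    rw [e]
    refine le_trans (mul_le_mul_right (measure_mono ?_) _) (hmax.trans ?_)
    · rintro s ⟨t, ht, h⟩
      exact h.trans (Finset.le_sup' (fun k => X k s) (Finset.mem_range.2 (Nat.lt_succ_of_le ht)))
    · rw [← ENNReal.ofReal_one, ← hint n]
      exact ENNReal.ofReal_le_ofReal (setIntegral_le_integral (hX.integrable n)
        (ae_of_all _ fun s => hX0 n s))
  rw [ENNReal.ofReal_inv_of_pos hc]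
  rw [mul_comm] at hle
  exact ENNReal.le_inv_iff_mul_le.2 hle

/-- Convergence of nonnegative martingales. -/
theorem ae_exists_tendsto_of_nonneg {Ω : Type*} {m0 : MeasurableSpace Ω} {μ : Measure Ω}
    [IsProbabilityMeasure μ] {ℱ : Filtration ℕ m0} {X : ℕ → Ω → ℝ} (hX : Martingale X ℱ μ)
    (hX0 : 0 ≤ X) : ∀ᵐ s ∂μ, ∃ l, Tendsto (fun t => X t s) atTop (𝓝 l) := by
  refine hX.submartingale.exists_ae_tendsto_of_bdd (R := (∫ s, X 0 s ∂μ).toNNReal) fun n => ?_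
  rw [eLpNorm_one_eq_lintegral_enorm]
  have h : ∫ s, X n s ∂μ = ∫ s, X 0 s ∂μ := by
    have := hX.setIntegral_eq (Nat.zero_le n) (s := Set.univ) MeasurableSet.univ
    simpa only [setIntegral_univ] using this.symm
  rw [← h, ← ENNReal.ofReal,
    ofReal_integral_eq_lintegral_ofReal (hX.integrable n) (ae_of_all _ fun s => hX0 n s)]
  refine lintegral_mono fun s => ?_
  rw [Real.enorm_of_nonneg (hX0 n s)]

variable {A Y : Type*}

/-- The product of `R` along a history. -/
def pathProd (R : A → Y → ℝ) (h : History A Y) : ℝ := (h.map fun p => R p.1 p.2).prod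

theorem pathProd_nil (R : A → Y → ℝ) : pathProd R [] = 1 := rfl

theorem pathProd_cons (R : A → Y → ℝ) (p : A × Y) (h : History A Y) :
    pathProd R (p :: h) = R p.1 p.2 * pathProd R h := by simp [pathProd]

theorem pathProd_append (R : A → Y → ℝ) (h h' : History A Y) :
    pathProd R (h ++ h') = pathProd R h * pathProd R h' := by simp [pathProd]

theorem pathProd_nonneg {R : A → Y → ℝ} (hR : ∀ a y, 0 ≤ R a y) (h : History A Y) :
    0 ≤ pathProd R h := by
  induction h with
  | nil => simp [pathProd]
  | cons p h ih => rw [pathProd_cons]; exact mul_nonneg (hR _ _) ih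

theorem pathProd_pos {R : A → Y → ℝ} (hR : ∀ a y, 0 < R a y) (h : History A Y) :
    0 < pathProd R h := by
  induction h with
  | nil => simp [pathProd]
  | cons p h ih => rw [pathProd_cons]; exact mul_pos (hR _ _) ih

theorem historyOf_depends_past {β : Type*} (φ : History A Y → β) (f : History A Y → A) (t : ℕ)
    (s s' : A × ℕ → Y) (h : ∀ i, i.2 < t → s i = s' i) :
    φ (historyOf f s t) = φ (historyOf f s' t) := by rw [historyOf_congr f h]

variable [MeasurableSpace Y]

/-- A nonnegative function of the outcome with mean one under the true distribution, for each
action. -/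
structure MeanOne (E : Environment A Y) (R : A → Y → ℝ) : Prop where
  measurable : ∀ a, Measurable (R a)
  nonneg : ∀ a y, 0 ≤ R a y
  integrable : ∀ a, Integrable (R a) (E.Q a)
  integral_eq : ∀ a, ∫ y, R a y ∂E.Q a = 1

theorem historyMeasurable_pathProd {R : A → Y → ℝ} (hR : ∀ a, Measurable (R a)) :
    HistoryMeasurable (pathProd R) := by
  intro w
  induction w with
  | nil => exact measurable_const
  | cons a w ih =>
    simp only [playOut, pathProd_cons]
    exact ((hR a).comp (measurable_pi_apply _)).mul ih

theorem nonempty_outcome (E : Environment A Y) (a : A) : Nonempty Y :=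
  nonempty_of_isProbabilityMeasure (E.Q a)

theorem measurePreserving_eval (E : Environment A Y) (i : A × ℕ) :
    MeasurePreserving (fun s : A × ℕ → Y => s i) E.P (E.Q i.1) :=
  measurePreserving_eval_infinitePi (fun i : A × ℕ => E.Q i.1) i

/-- The action is determined by the past and the new outcome is independent of it, so the new factor
has conditional mean one whichever action is chosen. -/
theorem martingale_pathProd [Fintype A] {E : Environment A Y} {R : A → Y → ℝ} (hR : MeanOne E R)
    {f : History A Y → A} (hf : MeasurableRule f) :
    Martingale (fun t s => pathProd R (historyOf f s t)) (pastFiltration A Y) E.P := by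
  classical
  have hY : Nonempty Y := nonempty_outcome E (f [])
  set X : ℕ → (A × ℕ → Y) → ℝ := fun t s => pathProd R (historyOf f s t) with hX
  have hXm : ∀ t, StronglyMeasurable[pastFiltration A Y t] (X t) := fun t =>
    (measurable_pastFiltration ((historyMeasurable_pathProd hR.measurable).comp_historyOf hf t)
      (historyOf_depends_past _ f t)).stronglyMeasurable
  set S : ℕ → A → Set (A × ℕ → Y) := fun t a => {s | f (historyOf f s t) = a} with hS
  have hSm : ∀ t a, MeasurableSet[pastFiltration A Y t] (S t a) := fun t a =>
    (@measurableSet_setOfPred _ (pastFiltration A Y t) _).2 (measurable_pastFiltration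
      (measurableSet_setOfPred.1 (hf.measurableSet_action_eq t a))
      (historyOf_depends_past (fun h => (f h = a : Prop)) f t))
  -- Splitting by the chosen action replaces the random coordinate by fixed ones: `Z` is known at
  -- `t`, `W` is independent of the past.
  set Z : ℕ → A → (A × ℕ → Y) → ℝ := fun t a => (S t a).indicator (X t)
  set W : ℕ → A → (A × ℕ → Y) → ℝ := fun t a s => R a (s (a, t))
  have hstep : ∀ t, X (t + 1) = ∑ a, Z t a * W t a := fun t => by
    ext s
    simp only [Finset.sum_apply, Pi.mul_apply]
    rw [Finset.sum_eq_single (f (historyOf f s t))]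
    · have : s ∈ S t (f (historyOf f s t)) := rfl
      simp only [Z, W, Set.indicator_of_mem this, hX, historyOf, pathProd_cons]
      ring
    · intro b _ hb
      have : s ∉ S t b := fun h => hb h.symm
      simp [Z, Set.indicator_of_notMem this]
    · simp
  have hZm : ∀ t a, StronglyMeasurable[pastFiltration A Y t] (Z t a) := fun t a =>
    (hXm t).indicator (hSm t a)
  have hWi : ∀ t a, Integrable (W t a) E.P := fun t a =>
    (measurePreserving_eval E (a, t)).integrable_comp_of_integrable (hR.integrable a)
  have hWm : ∀ t a, StronglyMeasurable[MeasurableSpace.comap (fun s : A × ℕ → Y => s (a, t))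
      inferInstance] (W t a) := fun t a =>
    ((hR.measurable a).comp (comap_measurable _)).stronglyMeasurable
  have hWint : ∀ t a, ∫ s, W t a s ∂E.P = 1 := fun t a => by
    rw [← hR.integral_eq a, ← (measurePreserving_eval E (a, t)).map_eq,
      integral_map (measurable_pi_apply _).aemeasurable (hR.measurable a).aestronglyMeasurable]
  have hprod : ∀ t a, Integrable (X t) E.P → Integrable (Z t a * W t a) E.P := fun t a hi => by
    refine IndepFun.integrable_mul ?_ (hi.indicator ((pastFiltration A Y).le t _ (hSm t a)))
      (hWi t a)
    exact indep_of_indep_of_le_left (indep_of_indep_of_le_right (indep_pastFiltration E a t).symm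
      (hWm t a).measurable.comap_le) (hZm t a).measurable.comap_le
  have hint : ∀ t, Integrable (X t) E.P := fun t => by
    induction t with
    | zero => simp [hX, historyOf, pathProd_nil]
    | succ t ih => rw [hstep]; exact integrable_finsetSum' _ fun a _ => hprod t a ih
  refine martingale_nat hXm hint fun t => ?_
  rw [hstep]
  have h1 : ∀ a, E.P[Z t a * W t a | pastFiltration A Y t] =ᵐ[E.P] Z t a := fun a => by
    have h2 := condExp_mul_of_stronglyMeasurable_left (hZm t a) (hprod t a (hint t)) (hWi t a)
    have h3 := condExp_indep_eq (measurable_pi_apply (a, t)).comap_le ((pastFiltration A Y).le t)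
      (hWm t a) (indep_pastFiltration E a t)
    filter_upwards [h2, h3] with s h2 h3
    rw [h2, Pi.mul_apply, h3, hWint, mul_one]
  have h4 := condExp_finsetSum (fun a (_ : a ∈ Finset.univ) => hprod t a (hint t))
    (pastFiltration A Y t)
  have h5 : ∀ᵐ s ∂E.P, ∀ a, (E.P[Z t a * W t a | pastFiltration A Y t]) s = Z t a s :=
    ae_all_iff.2 h1
  filter_upwards [h4, h5] with s h4 h5
  rw [h4, Finset.sum_apply, Finset.sum_congr rfl fun a _ => h5 a,
    Finset.sum_eq_single (f (historyOf f s t))]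
  · have : s ∈ S t (f (historyOf f s t)) := rfl
    simp only [Z, Set.indicator_of_mem this]
  · intro b _ hb
    have : s ∉ S t b := fun h => hb h.symm
    simp [Z, Set.indicator_of_notMem this]
  · simp

/-- A product of mean-one factors vanishes in the limit if an action for which the factor is not
degenerate is played infinitely often. -/
theorem ae_tendsto_pathProd_zero [Fintype A] {E : Environment A Y} {R : A → Y → ℝ}
    (hR : MeanOne E R) (hpos : ∀ a y, 0 < R a y) {f : History A Y → A} (hf : MeasurableRule f) :
    ∀ᵐ s ∂E.P, ∀ a, ¬ (R a =ᵐ[E.Q a] 1) → (∃ᶠ t in atTop, f (historyOf f s t) = a) →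
      Tendsto (fun t => pathProd R (historyOf f s t)) atTop (𝓝 0) := by
  -- The Hellinger affinity. The identity `∫ (√R - 1)² = 2 - 2ρ` gives `ρ ≤ 1`, with equality only
  -- if `R a` is one almost everywhere.
  set ρ : A → ℝ := fun a => ∫ y, √(R a y) ∂E.Q a
  have hsi : ∀ a, Integrable (fun y => √(R a y)) (E.Q a) := fun a => by
    refine Integrable.mono' ((hR.integrable a).add (integrable_const 1))
      (hR.measurable a).sqrt.aestronglyMeasurable (ae_of_all _ fun y => ?_)
    rw [Real.norm_of_nonneg (Real.sqrt_nonneg _), Pi.add_apply]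
    nlinarith [Real.sq_sqrt (hR.nonneg a y), Real.sqrt_nonneg (R a y), sq_nonneg (√(R a y) - 1)]
  have hsq : ∀ a, ∫ y, (√(R a y) - 1) ^ 2 ∂E.Q a = 2 - 2 * ρ a := fun a => by
    have : ∀ y, (√(R a y) - 1) ^ 2 = R a y - 2 * √(R a y) + 1 := fun y => by
      nlinarith [Real.sq_sqrt (hR.nonneg a y)]
    simp_rw [this]
    rw [integral_add (f := fun y => R a y - 2 * √(R a y))
        ((hR.integrable a).sub ((hsi a).const_mul 2)) (integrable_const 1),
      integral_sub (hR.integrable a) ((hsi a).const_mul 2), hR.integral_eq, integral_const_mul]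
    simp [ρ]; ring
  have hsqi : ∀ a, Integrable (fun y => (√(R a y) - 1) ^ 2) (E.Q a) := fun a => by
    have : (fun y => (√(R a y) - 1) ^ 2) = fun y => R a y - 2 * √(R a y) + 1 := by
      ext y; nlinarith [Real.sq_sqrt (hR.nonneg a y)]
    rw [this]
    exact ((hR.integrable a).sub ((hsi a).const_mul 2)).add (integrable_const 1)
  have hρ1 : ∀ a, ρ a ≤ 1 := fun a => by
    have := integral_nonneg (μ := E.Q a) (f := fun y => (√(R a y) - 1) ^ 2) fun y => sq_nonneg _
    rw [hsq] at this; linarith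
  have hρlt : ∀ a, ¬ (R a =ᵐ[E.Q a] 1) → ρ a < 1 := fun a ha => by
    refine lt_of_le_of_ne (hρ1 a) fun h => ha ?_
    have h0 : ∫ y, (√(R a y) - 1) ^ 2 ∂E.Q a = 0 := by rw [hsq, h]; ring
    rw [integral_eq_zero_iff_of_nonneg (fun y => sq_nonneg _) (hsqi a)] at h0
    filter_upwards [h0] with y hy
    have : √(R a y) = 1 := by
      have := pow_eq_zero_iff (two_ne_zero) |>.1 hy
      linarith
    simpa using (Real.sqrt_eq_one.1 this)
  have hρ0 : ∀ a, 0 < ρ a := fun a => by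
    refine (integral_pos_iff_support_of_nonneg (fun y => Real.sqrt_nonneg _) (hsi a)).2 ?_
    have : (Function.support fun y => √(R a y)) = Set.univ := by
      ext y; simp [(Real.sqrt_pos.2 (hpos a y)).ne']
    rw [this]; simp
  -- After normalization the square roots again have mean one, so their product converges to a
  -- finite limit.
  have hM : MeanOne E fun a y => √(R a y) / ρ a :=
    { measurable := fun a => (hR.measurable a).sqrt.div_const _
      nonneg := fun a y => div_nonneg (Real.sqrt_nonneg _) (hρ0 a).le
      integrable := fun a => (hsi a).div_const _
      integral_eq := fun a => by rw [integral_div]; exact div_self (hρ0 a).ne' }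
  filter_upwards [ae_exists_tendsto_of_nonneg (martingale_pathProd hM hf)
    fun t s => pathProd_nonneg hM.nonneg _] with s ⟨l, hl⟩ a ha hio
  set p : ℕ → ℝ := fun t => pathProd (fun a _ => ρ a) (historyOf f s t)
  have hp : ∀ t, p (t + 1) = ρ (f (historyOf f s t)) * p t := fun t => by
    simp [p, historyOf, pathProd_cons]
  have hp0 : ∀ t, 0 ≤ p t := fun t => pathProd_nonneg (fun a _ => (hρ0 a).le) _
  have hanti : Antitone p := antitone_nat_of_succ_le fun t => by
    rw [hp]; exact mul_le_of_le_one_left (hp0 t) (hρ1 _)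
  have hlim := tendsto_atTop_ciInf hanti ⟨0, by rintro _ ⟨t, rfl⟩; exact hp0 t⟩
  set q := ⨅ t, p t
  -- The product of affinities decreases to `q`, and infinitely often it is multiplied by `ρ a`; in
  -- the limit this forces `q = ρ a * q`.
  have hq : q = ρ a * q := by
    have h1 : Tendsto (fun t => p (t + 1) - ρ a * p t) atTop (𝓝 (q - ρ a * q)) :=
      ((tendsto_add_atTop_iff_nat 1).2 hlim).sub (hlim.const_mul _)
    have h2 : ∃ᶠ t in atTop, p (t + 1) - ρ a * p t = 0 :=
      hio.mono fun t ht => by rw [hp, ht, sub_self]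
    have h3 := isClosed_singleton.mem_of_frequently_of_tendsto (s := {(0 : ℝ)}) h2 h1
    linarith [Set.mem_singleton_iff.1 h3]
  have hq0 : q = 0 := by
    have h : (1 - ρ a) * q = 0 := by linarith
    exact (mul_eq_zero.1 h).resolve_left (by linarith [hρlt a ha])
  rw [hq0] at hlim
  -- The original product is the square of a convergent factor times a vanishing one.
  have heq : ∀ h : History A Y, pathProd R h =
      (pathProd (fun a y => √(R a y) / ρ a) h * pathProd (fun a _ => ρ a) h) ^ 2 := fun h => by
    induction h with
    | nil => simp [pathProd]
    | cons x h ih =>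
      simp only [pathProd_cons, ih]
      have := Real.sq_sqrt (hR.nonneg x.1 x.2)
      have h0 := (hρ0 x.1).ne'
      field_simp
      rw [this]
      ring
  simp_rw [heq]
  simpa using (hl.mul hlim).pow 2

end Martingales

/-! ### Likelihoods relative to the truth and posteriors -/

namespace SubjectiveModel

variable {A Y : Type*} [MeasurableSpace Y] {E : Environment A Y}

/-- The likelihood ratio of the parameter `ω` to the truth. -/
def ratio (θ : SubjectiveModel E) (ω : θ.Ω) (a : A) (y : Y) : ℝ := θ.q a ω y / E.q a y

theorem ratio_pos (θ : SubjectiveModel E) (ω : θ.Ω) (a : A) (y : Y) : 0 < θ.ratio ω a y :=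
  div_pos (θ.q_pos a ω y) (E.q_pos a y)

theorem measurable_ratio (θ : SubjectiveModel E) (ω : θ.Ω) (a : A) : Measurable (θ.ratio ω a) :=
  (θ.measurable_q a ω).div (E.measurable_q a)

theorem meanOne_ratio (θ : SubjectiveModel E) (ω : θ.Ω) : MeanOne E (θ.ratio ω) := by
  have hl : ∀ a, ∫⁻ y, ENNReal.ofReal (θ.ratio ω a y) ∂E.Q a = 1 := fun a => by
    rw [Environment.Q, lintegral_withDensity_eq_lintegral_mul _ (E.measurable_q a).ennreal_ofReal
      (θ.measurable_ratio ω a).ennreal_ofReal, ← θ.lintegral_q a ω]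
    refine lintegral_congr fun y => ?_
    rw [Pi.mul_apply, ← ENNReal.ofReal_mul (E.q_pos a y).le, ratio,
      mul_div_cancel₀ _ (E.q_pos a y).ne']
  have hn : ∀ a, 0 ≤ᵐ[E.Q a] θ.ratio ω a := fun a => ae_of_all _ fun y => (θ.ratio_pos ω a y).le
  refine ⟨θ.measurable_ratio ω, fun a y => (θ.ratio_pos ω a y).le, fun a => ?_, fun a => ?_⟩
  · refine ⟨(θ.measurable_ratio ω a).aestronglyMeasurable, ?_⟩
    rw [hasFiniteIntegral_iff_ofReal (hn a), hl]
    exact ENNReal.one_lt_top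
  · rw [integral_eq_lintegral_of_nonneg_ae (hn a) (θ.measurable_ratio ω a).aestronglyMeasurable, hl]
    rfl

/-- The likelihood of a history relative to the true likelihood. -/
def relLikelihood (θ : SubjectiveModel E) (π : θ.Belief) (h : History A Y) : ℝ :=
  ∑ ω, π.1 ω * pathProd (θ.ratio ω) h

theorem likelihood_eq (θ : SubjectiveModel E) (π : θ.Belief) (h : History A Y) :
    θ.likelihood π h = pathProd E.q h * θ.relLikelihood π h := by
  rw [likelihood, relLikelihood, Finset.mul_sum]
  refine Finset.sum_congr rfl fun ω _ => ?_
  rw [mul_left_comm]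
  congr 1
  induction h with
  | nil => simp [pathProd]
  | cons p h ih =>
    rw [List.map_cons, List.prod_cons, ih, pathProd_cons, pathProd_cons, ratio]
    have := (E.q_pos p.1 p.2).ne'
    field_simp

theorem relLikelihood_nil (θ : SubjectiveModel E) (π : θ.Belief) : θ.relLikelihood π [] = 1 := by
  simp only [relLikelihood, pathProd_nil, mul_one]
  exact π.2.2

theorem exists_pos (θ : SubjectiveModel E) (π : θ.Belief) : ∃ ω, 0 < π.1 ω := by
  by_contra! h
  have h1 : ∑ ω, π.1 ω = 0 := Finset.sum_eq_zero fun ω _ => le_antisymm (h ω) (π.2.1 ω)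
  exact one_ne_zero (π.2.2.symm.trans h1)

theorem relLikelihood_nonneg (θ : SubjectiveModel E) (π : θ.Belief) (h : History A Y) :
    0 ≤ θ.relLikelihood π h :=
  Finset.sum_nonneg fun ω _ =>
    mul_nonneg (π.2.1 ω) (pathProd_nonneg (fun a y => (θ.ratio_pos ω a y).le) h)

theorem le_relLikelihood (θ : SubjectiveModel E) (π : θ.Belief) (h : History A Y) (ω : θ.Ω) :
    π.1 ω * pathProd (θ.ratio ω) h ≤ θ.relLikelihood π h :=
  Finset.single_le_sum (f := fun ω => π.1 ω * pathProd (θ.ratio ω) h) (fun ω _ =>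
    mul_nonneg (π.2.1 ω) (pathProd_nonneg (fun a y => (θ.ratio_pos ω a y).le) h))
    (Finset.mem_univ ω)

theorem relLikelihood_pos (θ : SubjectiveModel E) (π : θ.Belief) (h : History A Y) :
    0 < θ.relLikelihood π h := by
  obtain ⟨ω, hω⟩ := θ.exists_pos π
  exact (mul_pos hω (pathProd_pos (θ.ratio_pos ω) h)).trans_le (θ.le_relLikelihood π h ω)

/-- The true likelihood is a positive common factor, so the switching rule can be read off the
martingales. -/
theorem likelihood_div_likelihood (θ θ' : SubjectiveModel E) (π : θ.Belief) (π' : θ'.Belief)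
    (h : History A Y) : θ'.likelihood π' h / θ.likelihood π h =
      θ'.relLikelihood π' h / θ.relLikelihood π h := by
  rw [likelihood_eq, likelihood_eq, mul_div_mul_left _ _ (pathProd_pos E.q_pos h).ne']

theorem posterior_apply (θ : SubjectiveModel E) (π : θ.Belief) (h : History A Y) (ω : θ.Ω) :
    (θ.posterior π h).1 ω = π.1 ω * pathProd (θ.ratio ω) h / θ.relLikelihood π h := by
  induction h generalizing ω with
  | nil => simp [posterior, relLikelihood_nil, pathProd_nil]
  | cons p h ih =>
    have hL := (θ.relLikelihood_pos π h).ne'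
    have hq := (E.q_pos p.1 p.2).ne'
    have e : ∀ ω', (θ.posterior π h).1 ω' * θ.q p.1 ω' p.2 =
        (E.q p.1 p.2 / θ.relLikelihood π h) * (π.1 ω' * pathProd (θ.ratio ω') (p :: h)) :=
      fun ω' => by
        rw [ih, pathProd_cons, ratio]
        field_simp
    change (θ.posterior π h).1 ω * θ.q p.1 ω p.2 /
      ∑ ω', (θ.posterior π h).1 ω' * θ.q p.1 ω' p.2 = _
    simp_rw [e]
    rw [← Finset.mul_sum, mul_div_mul_left _ _ (div_ne_zero hq hL)]
    rfl

theorem posterior_append (θ : SubjectiveModel E) (π : θ.Belief) (h h' : History A Y) :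
    θ.posterior π (h' ++ h) = θ.posterior (θ.posterior π h) h' := by
  induction h' with
  | nil => rfl
  | cons p h' ih => simp only [List.cons_append, posterior, ih]

/-- Chain rule: a run restarted at the posterior has the likelihood of the full run divided by that
of the past. This allows a posterior to be used as a new prior. -/
theorem relLikelihood_append (θ : SubjectiveModel E) (π : θ.Belief) (h h' : History A Y) :
    θ.relLikelihood π (h' ++ h) =
      θ.relLikelihood π h * θ.relLikelihood (θ.posterior π h) h' := by
  rw [relLikelihood, relLikelihood.eq_1 θ (θ.posterior π h), Finset.mul_sum]
  refine Finset.sum_congr rfl fun ω _ => ?_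
  have := (θ.relLikelihood_pos π h).ne'
  rw [posterior_apply, pathProd_append]
  field_simp

theorem FullSupport.posterior {θ : SubjectiveModel E} {π : θ.Belief} (hπ : θ.FullSupport π)
    (h : History A Y) : θ.FullSupport (θ.posterior π h) := fun ω => by
  rw [posterior_apply]
  exact div_pos (mul_pos (hπ ω) (pathProd_pos (θ.ratio_pos ω) h)) (θ.relLikelihood_pos π h)

theorem dogmatic_append (θ : SubjectiveModel E) (π : θ.Belief) (pol : θ.Belief → A)
    (h h' : History A Y) :
    θ.dogmatic π pol (h' ++ h) = θ.dogmatic (θ.posterior π h) pol h' := by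
  simp only [dogmatic, posterior_append]

theorem historyMeasurable_relLikelihood (θ : SubjectiveModel E) (π : θ.Belief) :
    HistoryMeasurable (θ.relLikelihood π) := fun w =>
  Finset.measurable_sum _ fun ω _ =>
    (historyMeasurable_pathProd (θ.measurable_ratio ω) w).const_mul _

theorem historyMeasurable_posterior (θ : SubjectiveModel E) (π : θ.Belief) :
    HistoryMeasurable (θ.posterior π) := fun w => by
  refine Measurable.subtype_mk (f := fun s => (θ.posterior π (playOut s w)).1) ?_
  refine measurable_pi_iff.2 fun ω => ?_
  simp_rw [posterior_apply]
  exact ((historyMeasurable_pathProd (θ.measurable_ratio ω) w).const_mul _).div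
    (θ.historyMeasurable_relLikelihood π w)

theorem measurableRule_dogmatic (θ : SubjectiveModel E) (π : θ.Belief) {pol : θ.Belief → A}
    (hpol : ∀ a, MeasurableSet (pol ⁻¹' {a})) : MeasurableRule (θ.dogmatic π pol) :=
  fun w a => θ.historyMeasurable_posterior π w (hpol a)

theorem martingale_relLikelihood [Fintype A] (θ : SubjectiveModel E) (π : θ.Belief)
    {f : History A Y → A} (hf : MeasurableRule f) :
    Martingale (fun t s => θ.relLikelihood π (historyOf f s t)) (pastFiltration A Y) E.P := by
  have h : ∀ I : Finset θ.Ω, Martingale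
      (∑ ω ∈ I, π.1 ω • fun t s => pathProd (θ.ratio ω) (historyOf f s t))
      (pastFiltration A Y) E.P := fun I =>
    Finset.sum_induction _ (fun X => Martingale X (pastFiltration A Y) E.P)
      (fun _ _ => Martingale.add) (martingale_zero _ _ _)
      fun ω _ => (martingale_pathProd (θ.meanOne_ratio ω) hf).smul _
  convert h Finset.univ using 1
  ext t s
  simp [relLikelihood, Finset.sum_apply]

theorem measure_exists_le_relLikelihood [Fintype A] (θ : SubjectiveModel E) (π : θ.Belief)
    {f : History A Y → A} (hf : MeasurableRule f) {c : ℝ} (hc : 0 < c) :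
    E.P {s | ∃ t, c ≤ θ.relLikelihood π (historyOf f s t)} ≤ ENNReal.ofReal c⁻¹ :=
  measure_exists_ge_le_inv (θ.martingale_relLikelihood π hf)
    (fun _ _ => θ.relLikelihood_nonneg π _) (by simp [historyOf, relLikelihood_nil]) hc

theorem measurableSet_modelChoice (α : ℝ) (θ θc : SubjectiveModel E) (π : θ.Belief)
    (πc : θc.Belief) (w : List A) :
    MeasurableSet {s : A × ℕ → Y | modelChoice α θ θc π πc (playOut s w) = Slot.initial} := by
  induction w with
  | nil => simp [playOut, modelChoice]
  | cons a w ih =>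
    have m1 := (θ.historyMeasurable_relLikelihood π (a :: w))
    have m2 := (θc.historyMeasurable_relLikelihood πc (a :: w))
    have h1 := measurableSet_lt measurable_const (m2.div m1) (f := fun _ => α)
    have h2 := measurableSet_lt measurable_const (m1.div m2) (f := fun _ => α)
    convert (ih.inter h1.compl).union (ih.compl.inter h2) using 1
    ext s
    simp only [playOut, modelChoice, likelihood_div_likelihood, Set.mem_ofPred_eq, Set.mem_union,
      Set.mem_inter_iff, Set.mem_compl_iff]
    cases modelChoice α θ θc π πc (playOut s w) <;> simp

theorem measurableRule_switcher (α : ℝ) (θ θc : SubjectiveModel E) (π : θ.Belief)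
    (πc : θc.Belief) {pol : θ.Belief → A} {polc : θc.Belief → A}
    (hpol : ∀ a, MeasurableSet (pol ⁻¹' {a})) (hpolc : ∀ a, MeasurableSet (polc ⁻¹' {a})) :
    MeasurableRule (switcher α θ θc π πc pol polc) := fun w a => by
  have h := measurableSet_modelChoice α θ θc π πc w
  convert (h.inter (measurableRule_dogmatic θ π hpol w a)).union
    (h.compl.inter (measurableRule_dogmatic θc πc hpolc w a)) using 1
  ext s
  simp only [switcher, dogmatic, Set.mem_ofPred_eq, Set.mem_union, Set.mem_inter_iff,
    Set.mem_compl_iff]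
  cases modelChoice α θ θc π πc (playOut s w) <;> simp

/-! ### Survival of the likelihood and the switcher who never switches -/

/-- With positive probability, the likelihood of the model relative to the truth stays bounded away
from zero along the path of the dogmatic modeler. -/
def LikelihoodSurvives (θ : SubjectiveModel E) (π : θ.Belief) (pol : θ.Belief → A) : Prop :=
  0 < E.P {s | ∃ c > 0, ∃ T, ∀ t ≥ T, c ≤ θ.relLikelihood π (historyOf (θ.dogmatic π pol) s t)}

theorem ae_ratio_eq_one {θ : SubjectiveModel E} {ω : θ.Ω} {a : A}
    (h : E.q a =ᵐ[E.ν] θ.q a ω) : θ.ratio ω a =ᵐ[E.Q a] 1 := by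
  filter_upwards [(withDensity_absolutelyContinuous E.ν _ : E.Q a ≪ E.ν) h] with y hy
  rw [ratio, ← hy, div_self (E.q_pos a y).ne', Pi.one_apply]

/-- One parameter in the support of the equilibrium belief suffices: almost surely its ratio is one
at all outcomes of equilibrium actions, so its term is constant from `T` on, and full support gives
that term positive weight. -/
theorem IsSelfConfirming.likelihoodSurvives [Fintype A] {θ : SubjectiveModel E}
    {σ : stdSimplex ℝ A} (hσ : θ.IsSelfConfirming σ) {π : θ.Belief} (hπ : θ.FullSupport π)
    {pol : θ.Belief → A} {T : ℕ}
    (hT : 0 < E.P {s | ∀ t ≥ T, θ.dogmatic π pol (historyOf (θ.dogmatic π pol) s t) ∈ supp σ}) :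
    θ.LikelihoodSurvives π pol := by
  obtain ⟨-, μ, -, -, hμ⟩ := hσ
  obtain ⟨ω, hω⟩ := θ.exists_pos μ
  have hae : ∀ᵐ s ∂E.P, ∀ a ∈ supp σ, ∀ t : ℕ, θ.ratio ω a (s (a, t)) = 1 := by
    rw [ae_all_iff]; intro a
    by_cases ha : a ∈ supp σ
    · have : ∀ᵐ s ∂E.P, ∀ t : ℕ, θ.ratio ω a (s (a, t)) = 1 := ae_all_iff.2 fun t =>
        (measurePreserving_eval E (a, t)).quasiMeasurePreserving.ae (ae_ratio_eq_one (hμ ω hω a ha))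
      filter_upwards [this] with s hs _ using hs
    · exact ae_of_all _ fun s h => absurd h ha
  refine hT.trans_le (measure_mono_ae ?_)
  filter_upwards [hae] with s hs hstay
  set H := historyOf (θ.dogmatic π pol) s
  refine ⟨π.1 ω * pathProd (θ.ratio ω) (H T),
    mul_pos (hπ ω) (pathProd_pos (θ.ratio_pos ω) _), T, fun t ht => ?_⟩
  have hconst : pathProd (θ.ratio ω) (H t) = pathProd (θ.ratio ω) (H T) := by
    induction t, ht using Nat.le_induction with
    | base => rfl
    | succ t ht ih =>
      have : H (t + 1) = (θ.dogmatic π pol (H t), s (θ.dogmatic π pol (H t), t)) :: H t := rfl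
      rw [this, pathProd_cons, ih, hs _ (hstay t ht), one_mul]
  rw [← hconst]
  exact θ.le_relLikelihood π (H t) ω

/-- From some posterior on, the relative likelihood falls only slightly with high probability. -/
theorem LikelihoodSurvives.exists_prior [Fintype A] {θ : SubjectiveModel E} {π : θ.Belief}
    {pol : θ.Belief → A} (hsurv : θ.LikelihoodSurvives π pol) (hπ : θ.FullSupport π)
    (hpol : ∀ a, MeasurableSet (pol ⁻¹' {a})) {β : ℝ} (hβ0 : 0 ≤ β) (hβ1 : β < 1) :
    ∃ π₁ : θ.Belief, θ.FullSupport π₁ ∧ ENNReal.ofReal β <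
      E.P {s | ∀ t, β ≤ θ.relLikelihood π₁ (historyOf (θ.dogmatic π₁ pol) s t)} := by
  have hf := θ.measurableRule_dogmatic π hpol
  set L : ℕ → (A × ℕ → Y) → ℝ := fun t s =>
    θ.relLikelihood π (historyOf (θ.dogmatic π pol) s t) with hL
  have hLm : ∀ t, Measurable (L t) := fun t =>
    (θ.historyMeasurable_relLikelihood π).comp_historyOf hf t
  set N : ℕ → Set (A × ℕ → Y) := fun n => {s | ∀ T, n ≤ T → ∀ t, T ≤ t → β * L T s ≤ L t s}
  have hNm : ∀ n, MeasurableSet (N n) := fun n =>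
    measurableSet_setOfPred.2 <| Measurable.forall fun T => Measurable.imp measurable_const <|
      Measurable.forall fun t => Measurable.imp measurable_const <|
        measurableSet_setOfPred.1 (measurableSet_le ((hLm T).const_mul β) (hLm t))
  have hconv := ae_exists_tendsto_of_nonneg (θ.martingale_relLikelihood π hf)
    fun t s => θ.relLikelihood_nonneg π _
  have hpos : 0 < E.P (⋃ n, N n) := by
    refine hsurv.trans_le (measure_mono_ae ?_)
    filter_upwards [hconv] with s ⟨l, hl⟩ ⟨c, hc, T, hT⟩
    have hl0 : 0 < l := hc.trans_le (ge_of_tendsto hl (eventually_atTop.2 ⟨T, hT⟩))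
    -- The factor `2 / (1 + β)` exceeds 1 while `β` times it is below 1; late values of the process
    -- lie strictly between the two resulting multiples of the limit.
    have h1 : l < 2 / (1 + β) * l := by
      refine lt_mul_of_one_lt_left hl0 ?_
      rw [lt_div_iff₀ (by linarith)]; linarith
    have h2 : β * (2 / (1 + β) * l) < l := by
      rw [← mul_assoc]
      refine mul_lt_of_lt_one_left hl0 ?_
      rw [mul_div_assoc', div_lt_one (by linarith)]; linarith
    obtain ⟨n, hn⟩ := eventually_atTop.1
      ((hl.eventually (gt_mem_nhds h1)).and (hl.eventually (lt_mem_nhds h2)))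
    refine Set.mem_iUnion.2 ⟨n, fun T hT t ht => ?_⟩
    exact (mul_le_mul_of_nonneg_left (hn T hT).1.le hβ0).trans (hn t (hT.trans ht)).2.le
  obtain ⟨n, hn⟩ : ∃ n, 0 < E.P (N n) := by
    by_contra! h
    exact hpos.ne' (measure_iUnion_null fun n => le_antisymm (h n) bot_le)
  obtain ⟨T, hT, s, hs⟩ := exists_splice_gt E n (hNm n) hn hβ0 hβ1
  set h := historyOf (θ.dogmatic π pol) s T with hh
  refine ⟨θ.posterior π h, hπ.posterior h, hs.trans_le (measure_mono fun s' hs' t => ?_)⟩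
  have key : β * L T (splice T s s') ≤ L (T + t) (splice T s s') := hs' T hT _ (Nat.le_add_right _ _)
  simp only [hL, historyOf_splice, historyOf_splice_self, ← hh, dogmatic_append,
    relLikelihood_append] at key
  rw [mul_comm] at key
  exact le_of_mul_le_mul_left key (θ.relLikelihood_pos π h)

theorem switcher_of_initial {α : ℝ} {θ θc : SubjectiveModel E} {π : θ.Belief} {πc : θc.Belief}
    {pol : θ.Belief → A} {polc : θc.Belief → A} {h : History A Y}
    (hm : modelChoice α θ θc π πc h = Slot.initial) :
    switcher α θ θc π πc pol polc h = pol (θ.posterior π h) := by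
  simp only [switcher, hm]

/-- As long as the Bayes factor along the dogmatic path stays below the threshold, the switcher
behaves like the dogmatic modeler. -/
theorem modelPath_eq_initial {α : ℝ} {θ θc : SubjectiveModel E} {π : θ.Belief} {πc : θc.Belief}
    {pol : θ.Belief → A} {polc : θc.Belief → A} {s : A × ℕ → Y}
    (h : ∀ t, θc.relLikelihood πc (historyOf (θ.dogmatic π pol) s t) /
      θ.relLikelihood π (historyOf (θ.dogmatic π pol) s t) ≤ α) (t : ℕ) :
    modelPath α θ θc π πc pol polc s t = Slot.initial := by
  have hmc : ∀ t, modelChoice α θ θc π πc (historyOf (θ.dogmatic π pol) s t) = Slot.initial :=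
    fun t => by
      induction t with
      | zero => rfl
      | succ t ih =>
        have ht := h (t + 1)
        simp only [historyOf] at ht ⊢
        simp only [modelChoice, ih, likelihood_div_likelihood, not_lt.2 ht, if_false]
  have hhist : ∀ t, historyOf (switcher α θ θc π πc pol polc) s t =
      historyOf (θ.dogmatic π pol) s t := fun t => by
    induction t with
    | zero => rfl
    | succ t ih => simp only [historyOf, ih, switcher_of_initial (hmc t), dogmatic]
  rw [modelPath, hhist, hmc]

theorem LikelihoodSurvives.exists_neverSwitches [Fintype A] {θ : SubjectiveModel E} {π : θ.Belief}
    {pol : θ.Belief → A} (hsurv : θ.LikelihoodSurvives π pol) (hπ : θ.FullSupport π)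
    (hpol : ∀ a, MeasurableSet (pol ⁻¹' {a})) {α : ℝ} (hα : 1 < α) :
    ∃ π₁ : θ.Belief, θ.FullSupport π₁ ∧ ∀ (θc : SubjectiveModel E) (πc : θc.Belief)
      (polc : θc.Belief → A), NeverSwitches α θ θc π₁ πc pol polc := by
  have hα0 : 0 < α := one_pos.trans hα
  -- The midpoint of `1 / α` and 1. The inequality `1 / (α * β) < β` amounts to `4 * α < (α + 1) ^
  -- 2`, that is, to `α ≠ 1`.
  set β := (α + 1) / (2 * α) with hβ
  have hβ0 : 0 < β := by positivity
  have hβ1 : β < 1 := by rw [hβ, div_lt_one (by positivity)]; linarith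
  have hαβ : (α * β)⁻¹ < β := by
    have : α * β = (α + 1) / 2 := by rw [hβ]; field_simp
    rw [this, hβ, inv_div, div_lt_div_iff₀ (by positivity) (by positivity)]
    nlinarith [sq_pos_of_pos (sub_pos.2 hα)]
  obtain ⟨π₁, hπ₁, hP⟩ := hsurv.exists_prior hπ hpol hβ0.le hβ1
  refine ⟨π₁, hπ₁, fun θc πc polc => ?_⟩
  -- The competitor reaches `α * β` with probability below `β`, while the model stays above `β` with
  -- probability more than `β`; where only the latter happens, the Bayes factor never exceeds `α`.
  -- The prior `π₁` was fixed before the competitor.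
  have hV := θc.measure_exists_le_relLikelihood πc (θ.measurableRule_dogmatic π₁ hpol)
    (mul_pos hα0 hβ0)
  set D₁ := {s | ∀ t, β ≤ θ.relLikelihood π₁ (historyOf (θ.dogmatic π₁ pol) s t)}
  set D₂ := {s | ∃ t, α * β ≤ θc.relLikelihood πc (historyOf (θ.dogmatic π₁ pol) s t)}
  have hlt : E.P D₂ < E.P D₁ :=
    hV.trans_lt ((ENNReal.ofReal_lt_ofReal_iff hβ0).2 hαβ |>.trans hP)
  have hD : 0 < E.P (D₁ \ D₂) := by
    refine pos_iff_ne_zero.2 fun h0 => hlt.not_ge ?_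
    calc E.P D₁ ≤ E.P (D₁ \ D₂ ∪ D₂) := measure_mono (by simp)
      _ ≤ E.P (D₁ \ D₂) + E.P D₂ := measure_union_le _ _
      _ = E.P D₂ := by rw [h0, zero_add]
  refine hD.trans_le (measure_mono fun s hs => modelPath_eq_initial fun t => ?_)
  rw [div_le_iff₀ (θ.relLikelihood_pos _ _)]
  exact (not_le.1 (not_exists.1 hs.2 t)).le.trans (mul_le_mul_of_nonneg_left (hs.1 t) hα0.le)

theorem NeverSwitches.persistsAgainst {α : ℝ} {θ θc : SubjectiveModel E} {π : θ.Belief}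
    {πc : θc.Belief} {pol : θ.Belief → A} {polc : θc.Belief → A}
    (h : NeverSwitches α θ θc π πc pol polc) : PersistsAgainst α θ θc π πc pol polc :=
  h.trans_le (measure_mono fun _ hs => ⟨0, fun t _ => hs t⟩)

end SubjectiveModel

/-! ### The true model as competitor -/

/-- The correctly specified model with a single parameter. -/
def Environment.trueModel {A Y : Type*} [MeasurableSpace Y] (E : Environment A Y) :
    SubjectiveModel E where
  dim := 0
  Ω := {0}
  Ω_nonempty := Finset.singleton_nonempty _
  q a _ := E.q a
  measurable_q a _ := E.measurable_q a
  q_pos a _ := E.q_pos a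
  lintegral_q a _ := E.lintegral_q a
  integrable_u a _ := E.integrable_u a
  dominated a _ := ⟨0, MemLp.zero, ae_of_all _ fun y => by
    simp [div_self (E.q_pos a y).ne']⟩

namespace SubjectiveModel

variable {A Y : Type*} [MeasurableSpace Y] {E : Environment A Y}

instance : Unique E.trueModel.Ω := inferInstanceAs (Unique (({0} : Finset _) : Type))

theorem belief_trueModel_apply (π : E.trueModel.Belief) (ω : E.trueModel.Ω) : π.1 ω = 1 := by
  rw [Unique.eq_default ω, ← π.2.2, Fintype.sum_unique]

theorem relLikelihood_trueModel (π : E.trueModel.Belief) (h : History A Y) :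
    E.trueModel.relLikelihood π h = 1 := by
  have : ∀ ω, pathProd (E.trueModel.ratio ω) h = 1 := fun ω => by
    induction h with
    | nil => rfl
    | cons p h ih =>
      rw [pathProd_cons, ih, mul_one]
      exact div_self (E.q_pos p.1 p.2).ne'
  simp only [relLikelihood, this, mul_one]
  exact π.2.2

/-- Robustness can be tested against the true model only if that model has an optimal policy. With a
single parameter nothing is learned, and repeating the best action is optimal. -/
theorem exists_isOptimalPolicy_trueModel [Fintype A] [Nonempty A] :
    ∃ pol, E.trueModel.IsOptimalPolicy pol := by
  obtain ⟨a, ha⟩ := Finite.exists_max fun a => ∫ y, E.u a y ∂E.Q a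
  set v := ∫ y, E.u a y ∂E.Q a
  have hδ : (1 - E.δ) ≠ 0 := by linarith [E.δ_lt_one]
  have hval : ∀ π b, E.trueModel.actionValue E.δ (fun _ => v / (1 - E.δ)) π b =
      ∫ y, E.u b y ∂E.Q b + E.δ * (v / (1 - E.δ)) := fun π b => by
    have hQ : ∀ ω, E.trueModel.Q b ω = E.Q b := fun ω => rfl
    simp only [actionValue, Fintype.sum_unique, belief_trueModel_apply, one_mul, hQ]
    rw [integral_add (μ := E.Q b) (E.integrable_u b) (integrable_const _)]
    simp
  refine ⟨fun _ => a, fun b => MeasurableSet.const (a ∈ ({b} : Set A)),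
    fun _ => v / (1 - E.δ), ⟨measurable_const, ⟨_, fun _ => le_rfl⟩, fun π => ⟨⟨a, ?_⟩, ?_⟩⟩, ?_⟩
  · simp only [hval]
    change v + _ = _
    field_simp
    ring
  · rintro _ ⟨b, rfl⟩
    simp only [hval]
    have := ha b
    have e : v + E.δ * (v / (1 - E.δ)) = v / (1 - E.δ) := by field_simp; ring
    linarith
  · intro π b
    simp only [hval]
    linarith [ha b]

/-- If the switcher plays `θ` from period `T` on, then she behaves like the dogmatic modeler with
the posterior of period `T`. -/
theorem historyOf_switcher_splice {α : ℝ} {θ θc : SubjectiveModel E} {π : θ.Belief}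
    {πc : θc.Belief} {pol : θ.Belief → A} {polc : θc.Belief → A} {T : ℕ} {s s' : A × ℕ → Y}
    (h : ∀ t ≥ T, modelPath α θ θc π πc pol polc (splice T s s') t = Slot.initial) (t : ℕ) :
    historyOf (switcher α θ θc π πc pol polc) (splice T s s') (T + t) =
      historyOf (θ.dogmatic (θ.posterior π (historyOf (switcher α θ θc π πc pol polc) s T)) pol)
        s' t ++ historyOf (switcher α θ θc π πc pol polc) s T := by
  rw [historyOf_splice]
  congr 1
  induction t with
  | zero => rfl
  | succ t ih =>
    have ht := h (T + t) (Nat.le_add_right _ _)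
    rw [modelPath, historyOf_splice] at ht
    have hs := switcher_of_initial (pol := pol) (polc := polc) ht
    simp only [historyOf]
    rw [hs, ih, posterior_append]
    rfl

theorem PersistsAgainst.likelihoodSurvives [Fintype A] {α : ℝ} (hα : 1 < α)
    {θ : SubjectiveModel E} {π : θ.Belief} {πc : E.trueModel.Belief} {pol : θ.Belief → A}
    {polc : E.trueModel.Belief → A} (hπ : θ.FullSupport π)
    (hpol : ∀ a, MeasurableSet (pol ⁻¹' {a})) (hpolc : ∀ a, MeasurableSet (polc ⁻¹' {a}))
    (h : PersistsAgainst α θ E.trueModel π πc pol polc) :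
    ∃ π₁ : θ.Belief, θ.FullSupport π₁ ∧ θ.LikelihoodSurvives π₁ pol := by
  set N : ℕ → Set (A × ℕ → Y) := fun T =>
    {s | ∀ t, T ≤ t → modelPath α θ E.trueModel π πc pol polc s t = Slot.initial} with hN
  have hf := measurableRule_switcher α θ E.trueModel π πc hpol hpolc
  have hNm : ∀ T, MeasurableSet (N T) := fun T => by
    refine measurableSet_setOfPred.2 <| Measurable.forall fun t =>
      Measurable.imp measurable_const ?_
    have hm : HistoryMeasurable fun h : History A Y =>
        (modelChoice α θ E.trueModel π πc h = Slot.initial : Prop) := fun w =>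
      measurableSet_setOfPred.1 (measurableSet_modelChoice α θ E.trueModel π πc w)
    exact hm.comp_historyOf hf t
  obtain ⟨T, hT⟩ : ∃ T, 0 < E.P (N T) := by
    by_contra! hcon
    refine h.ne' (measure_mono_null ?_ (measure_iUnion_null fun n =>
      le_antisymm (hcon n) bot_le))
    rintro s ⟨T, hT⟩
    exact Set.mem_iUnion.2 ⟨T, hT⟩
  obtain ⟨s, hs⟩ := exists_splice_pos E T (hNm T) hT
  set H := historyOf (switcher α θ E.trueModel π πc pol polc) s T with hH
  refine ⟨θ.posterior π H, hπ.posterior H, hs.trans_le (measure_mono fun s' hs' => ?_)⟩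
  have hL := θ.relLikelihood_pos π H
  have hα0 : 0 < α := one_pos.trans hα
  -- Not switching means a total relative likelihood of at least `1 / α`; dividing by the past part
  -- gives this constant. The bound starts one period after `T`, because the test is informative
  -- only if `θ` was already in use the period before.
  refine ⟨1 / (α * θ.relLikelihood π H), by positivity, 1, fun t ht => ?_⟩
  obtain ⟨t, rfl⟩ := Nat.exists_eq_add_of_le' ht
  have h1 := hs' (T + t) (Nat.le_add_right _ _)
  have h2 := hs' (T + t + 1) (by omega)
  have h3 := historyOf_switcher_splice hs' (t + 1)
  rw [modelPath] at h1 h2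
  have h4 : ¬ α < E.trueModel.relLikelihood πc (historyOf (switcher α θ E.trueModel π πc pol polc)
      (splice T s s') (T + t + 1)) / θ.relLikelihood π (historyOf
        (switcher α θ E.trueModel π πc pol polc) (splice T s s') (T + t + 1)) := by
    rw [← likelihood_div_likelihood]
    intro hlt
    simp only [historyOf] at h2 hlt
    simp only [modelChoice, h1, hlt, if_true] at h2
    cases h2
  rw [add_assoc, h3, ← hH, relLikelihood_trueModel, relLikelihood_append, not_lt,
    div_le_iff₀ (mul_pos hL (θ.relLikelihood_pos _ _))] at h4
  rw [div_le_iff₀ (by positivity)]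
  linarith

/-! ### Dynamic programming on the belief simplex -/

instance (θ : SubjectiveModel E) (a : A) (ω : θ.Ω) : IsProbabilityMeasure (θ.Q a ω) := by
  refine ⟨?_⟩
  rw [Q, withDensity_apply _ MeasurableSet.univ, Measure.restrict_univ]
  exact θ.lintegral_q a ω

theorem integrable_q (θ : SubjectiveModel E) (a : A) (ω : θ.Ω) : Integrable (θ.q a ω) E.ν := by
  refine ⟨(θ.measurable_q a ω).aestronglyMeasurable, ?_⟩
  rw [hasFiniteIntegral_iff_ofReal (ae_of_all _ fun y => (θ.q_pos a ω y).le), θ.lintegral_q]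
  exact ENNReal.one_lt_top

theorem integral_q (θ : SubjectiveModel E) (a : A) (ω : θ.Ω) : ∫ y, θ.q a ω y ∂E.ν = 1 := by
  rw [integral_eq_lintegral_of_nonneg_ae (ae_of_all _ fun y => (θ.q_pos a ω y).le)
    (θ.measurable_q a ω).aestronglyMeasurable, θ.lintegral_q]
  rfl

theorem integral_Q (θ : SubjectiveModel E) (a : A) (ω : θ.Ω) (g : Y → ℝ) :
    ∫ y, g y ∂θ.Q a ω = ∫ y, θ.q a ω y * g y ∂E.ν := by
  rw [Q, integral_withDensity_eq_integral_toReal_smul (θ.measurable_q a ω).ennreal_ofReal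
    (ae_of_all _ fun y => ENNReal.ofReal_lt_top)]
  simp only [ENNReal.toReal_ofReal (θ.q_pos a ω _).le, smul_eq_mul]

theorem measurable_bayes (θ : SubjectiveModel E) (a : A) (π : θ.Belief) :
    Measurable fun y => θ.bayes a y π := by
  refine Measurable.subtype_mk (f := fun y => (θ.bayes a y π).1) (measurable_pi_iff.2 fun ω => ?_)
  exact ((θ.measurable_q a ω).const_mul _).div
    (Finset.measurable_sum _ fun ω' _ => (θ.measurable_q a ω').const_mul _)

theorem continuous_bayes (θ : SubjectiveModel E) (a : A) (y : Y) :
    Continuous fun π => θ.bayes a y π := by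
  have h : ∀ ω, Continuous fun π : θ.Belief => π.1 ω := fun ω =>
    (continuous_apply ω).comp continuous_subtype_val
  refine Continuous.subtype_mk (continuous_pi fun ω => ?_) _
  exact ((h ω).mul continuous_const).div
    (continuous_finsetSum _ fun ω' _ => (h ω').mul continuous_const)
    fun π => (θ.predictive_pos a y π).ne'

/-- The expected flow payoff of an action at a parameter. -/
def payoff (θ : SubjectiveModel E) (a : A) (ω : θ.Ω) : ℝ := ∫ y, E.u a y ∂θ.Q a ω

theorem integrable_comp_bayes (θ : SubjectiveModel E) {U : θ.Belief → ℝ} (hU : Measurable U)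
    {C : ℝ} (hC : ∀ π, |U π| ≤ C) (a : A) (π : θ.Belief) (ω : θ.Ω) :
    Integrable (fun y => U (θ.bayes a y π)) (θ.Q a ω) :=
  Integrable.of_bound (hU.comp (θ.measurable_bayes a π)).aestronglyMeasurable C
    (ae_of_all _ fun _ => hC _)

theorem actionValue_eq (θ : SubjectiveModel E) (d : ℝ) {U : θ.Belief → ℝ} (hU : Measurable U)
    {C : ℝ} (hC : ∀ π, |U π| ≤ C) (π : θ.Belief) (a : A) :
    θ.actionValue d U π a = ∑ ω, π.1 ω * θ.payoff a ω +
      d * ∑ ω, π.1 ω * ∫ y, U (θ.bayes a y π) ∂θ.Q a ω := by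
  rw [actionValue, Finset.mul_sum, ← Finset.sum_add_distrib]
  refine Finset.sum_congr rfl fun ω _ => ?_
  rw [integral_add (μ := θ.Q a ω) (θ.integrable_u a ω)
    ((θ.integrable_comp_bayes hU hC a π ω).const_mul d), integral_const_mul, payoff]
  ring

theorem actionValue_zero (θ : SubjectiveModel E) (π : θ.Belief) (a : A) :
    θ.actionValue 0 0 π a = ∑ ω, π.1 ω * θ.payoff a ω := by
  rw [θ.actionValue_eq 0 (U := 0) measurable_const (C := 0) (by simp)]
  simp

/-- Monotonicity and discounting, in one-sided form for each action: iteration yields both the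
contraction estimate and comparisons with fixed plans. -/
theorem actionValue_le_add (θ : SubjectiveModel E) {d : ℝ} (hd : 0 ≤ d) {U V : θ.Belief → ℝ}
    (hU : Measurable U) {C : ℝ} (hC : ∀ π, |U π| ≤ C) (hV : Measurable V) {C' : ℝ}
    (hC' : ∀ π, |V π| ≤ C') {ε : ℝ} (h : ∀ π, U π ≤ V π + ε) (π : θ.Belief) (a : A) :
    θ.actionValue d U π a ≤ θ.actionValue d V π a + d * ε := by
  rw [θ.actionValue_eq d hU hC, θ.actionValue_eq d hV hC', add_assoc, ← mul_add]
  gcongr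
  calc ∑ ω, π.1 ω * ∫ y, U (θ.bayes a y π) ∂θ.Q a ω
      ≤ ∑ ω, (π.1 ω * ∫ y, V (θ.bayes a y π) ∂θ.Q a ω + π.1 ω * ε) := by
        refine Finset.sum_le_sum fun ω _ => ?_
        rw [← mul_add]
        refine mul_le_mul_of_nonneg_left ?_ (π.2.1 ω)
        have hVi := θ.integrable_comp_bayes hV hC' a π ω
        calc ∫ y, U (θ.bayes a y π) ∂θ.Q a ω
            ≤ ∫ y, (V (θ.bayes a y π) + ε) ∂θ.Q a ω :=
              integral_mono (θ.integrable_comp_bayes hU hC a π ω)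
                (hVi.add (integrable_const ε)) fun y => h _
          _ = _ := by rw [integral_add hVi (integrable_const ε)]; simp
    _ = _ := by
        rw [Finset.sum_add_distrib, ← Finset.sum_mul]
        have : ∑ ω, π.1 ω = 1 := π.2.2
        rw [this, one_mul]

theorem continuous_actionValue (θ : SubjectiveModel E) (d : ℝ) {U : θ.Belief → ℝ}
    (hU : Continuous U) {C : ℝ} (hC : ∀ π, |U π| ≤ C) (a : A) :
    Continuous fun π => θ.actionValue d U π a := by
  have h : ∀ ω, Continuous fun π : θ.Belief => π.1 ω := fun ω =>
    (continuous_apply ω).comp continuous_subtype_val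
  simp_rw [θ.actionValue_eq d hU.measurable hC]
  refine (continuous_finsetSum _ fun ω _ => (h ω).mul continuous_const).add
    (continuous_const.mul (continuous_finsetSum _ fun ω _ => (h ω).mul ?_))
  exact continuous_of_dominated
    (fun π => (hU.measurable.comp (θ.measurable_bayes a π)).aestronglyMeasurable)
    (fun π => ae_of_all _ fun y => hC _) (integrable_const C)
    (ae_of_all _ fun y => hU.comp (θ.continuous_bayes a y))

/-- The value function is a uniform limit of continuous value iterates. -/
theorem IsValueFunction.continuous [Fintype A] [Nonempty A] {θ : SubjectiveModel E}
    {U : θ.Belief → ℝ} (hU : θ.IsValueFunction U) : Continuous U := by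
  obtain ⟨hUm, ⟨C, hC⟩, hG⟩ := hU
  -- Value iteration from zero: the maximum over actions preserves continuity, and each step shrinks
  -- the distance to `U` by `E.δ`.
  have hex : ∀ n : ℕ, ∃ V : θ.Belief → ℝ, Continuous V ∧ ∀ π, |U π - V π| ≤ E.δ ^ n * C := by
    intro n
    induction n with
    | zero => exact ⟨fun _ => 0, continuous_const, by simpa using hC⟩
    | succ n ih =>
      obtain ⟨V, hV, hUV⟩ := ih
      have hVC : ∀ π, |V π| ≤ C + E.δ ^ n * C := fun π => by
        calc |V π| = |U π - (U π - V π)| := by ring_nf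
          _ ≤ |U π| + |U π - V π| := abs_sub _ _
          _ ≤ _ := add_le_add (hC π) (hUV π)
      have h1 := θ.actionValue_le_add E.δ_nonneg hUm hC hV.measurable hVC
        (ε := E.δ ^ n * C) fun π => by linarith [(abs_le.1 (hUV π)).2]
      have h2 := θ.actionValue_le_add E.δ_nonneg hV.measurable hVC hUm hC
        (ε := E.δ ^ n * C) fun π => by linarith [(abs_le.1 (hUV π)).1]
      refine ⟨fun π => Finset.univ.sup' Finset.univ_nonempty fun a => θ.actionValue E.δ V π a,
        Continuous.finset_sup'_apply _ fun a _ => θ.continuous_actionValue E.δ hV hVC a,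
        fun π => ?_⟩
      rw [pow_succ', mul_assoc, abs_le]
      obtain ⟨⟨a, ha⟩, hmax⟩ := hG π
      obtain ⟨b, -, hb⟩ := Finset.exists_mem_eq_sup' (s := Finset.univ) Finset.univ_nonempty
        fun a => θ.actionValue E.δ V π a
      constructor
      · simp only [hb]
        linarith [h2 π b, hmax ⟨b, rfl⟩]
      · have := Finset.le_sup' (fun a => θ.actionValue E.δ V π a) (Finset.mem_univ a)
        simp only at ha
        linarith [h1 π a]
  choose V hVc hV using hex
  have ht : Tendsto (fun n : ℕ => E.δ ^ n * C) atTop (𝓝 0) := by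
    simpa using (tendsto_pow_atTop_nhds_zero_of_lt_one E.δ_nonneg E.δ_lt_one).mul_const C
  refine TendstoUniformly.continuous (F := V) (p := atTop) ?_ (Eventually.of_forall hVc).frequently
  refine Metric.tendstoUniformly_iff.2 fun ε hε => ?_
  filter_upwards [ht.eventually (gt_mem_nhds hε)] with n hn π
  rw [Real.dist_eq]
  exact (hV n π).trans_lt hn

/-- Beliefs are a martingale under the predictive distribution. -/
theorem sum_integral_linear_bayes (θ : SubjectiveModel E) (v : θ.Ω → ℝ) (a : A) (π : θ.Belief) :
    ∑ ω, π.1 ω * ∫ y, (∑ ω', (θ.bayes a y π).1 ω' * v ω') ∂θ.Q a ω = ∑ ω, π.1 ω * v ω := by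
  have hb : ∀ ω' y, |(θ.bayes a y π).1 ω'| ≤ 1 := fun ω' y => by
    rw [abs_of_nonneg ((θ.bayes a y π).2.1 ω')]
    have : ∑ ω, (θ.bayes a y π).1 ω = 1 := (θ.bayes a y π).2.2
    rw [← this]
    exact Finset.single_le_sum (fun ω _ => (θ.bayes a y π).2.1 ω) (Finset.mem_univ ω')
  have hm : ∀ ω', Measurable fun y => (θ.bayes a y π).1 ω' := fun ω' =>
    (measurable_pi_apply ω').comp (measurable_subtype_coe.comp (θ.measurable_bayes a π))
  have hi : ∀ ω ω', Integrable (fun y => θ.q a ω y * (θ.bayes a y π).1 ω') E.ν := fun ω ω' =>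
    (θ.integrable_q a ω).mul_bdd (c := 1) (hm ω').aestronglyMeasurable
      (ae_of_all _ fun y => hb ω' y)
  have h1 : ∀ ω, ∫ y, (∑ ω', (θ.bayes a y π).1 ω' * v ω') ∂θ.Q a ω =
      ∑ ω', v ω' * ∫ y, θ.q a ω y * (θ.bayes a y π).1 ω' ∂E.ν := fun ω => by
    rw [integral_Q]
    simp_rw [Finset.mul_sum, ← integral_const_mul]
    rw [← integral_finsetSum _ fun ω' _ => (hi ω ω').const_mul (v ω')]
    refine integral_congr_ae (ae_of_all _ fun y => Finset.sum_congr rfl fun ω' _ => by ring)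
  simp_rw [h1, Finset.mul_sum]
  rw [Finset.sum_comm]
  refine Finset.sum_congr rfl fun ω' _ => ?_
  -- Summing over the true parameter first produces the predictive density, which cancels the
  -- denominator in Bayes' rule.
  have h2 : ∫ y, (∑ ω, π.1 ω * (θ.q a ω y * (θ.bayes a y π).1 ω')) ∂E.ν = π.1 ω' := by
    have : ∀ y, ∑ ω, π.1 ω * (θ.q a ω y * (θ.bayes a y π).1 ω') = π.1 ω' * θ.q a ω' y := fun y => by
      simp_rw [← mul_assoc]
      rw [← Finset.sum_mul]
      exact mul_div_cancel₀ _ (θ.predictive_pos a y π).ne'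
    simp_rw [this]
    rw [integral_const_mul, integral_q, mul_one]
  rw [integral_finsetSum _ fun ω _ => (hi ω ω').const_mul _] at h2
  simp_rw [integral_const_mul] at h2
  rw [← h2, Finset.sum_mul]
  refine Finset.sum_congr rfl fun ω _ => by ring

theorem abs_sum_belief_le (θ : SubjectiveModel E) (v : θ.Ω → ℝ) (π : θ.Belief) :
    |∑ ω, π.1 ω * v ω| ≤ ∑ ω, |v ω| := by
  refine (Finset.abs_sum_le_sum_abs _ _).trans (Finset.sum_le_sum fun ω _ => ?_)
  have h1 : π.1 ω ≤ 1 := by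
    have : ∑ ω, π.1 ω = 1 := π.2.2
    rw [← this]
    exact Finset.single_le_sum (fun ω _ => π.2.1 ω) (Finset.mem_univ ω)
  rw [abs_mul, abs_of_nonneg (π.2.1 ω)]
  exact mul_le_of_le_one_left (abs_nonneg _) h1

theorem measurable_sum_belief (θ : SubjectiveModel E) (v : θ.Ω → ℝ) :
    Measurable fun π : θ.Belief => ∑ ω, π.1 ω * v ω :=
  Finset.measurable_sum _ fun ω _ =>
    ((measurable_pi_apply ω).comp measurable_subtype_coe).mul_const _

theorem actionValue_linear (θ : SubjectiveModel E) (d : ℝ) (v : θ.Ω → ℝ) (π : θ.Belief) (a : A) :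
    θ.actionValue d (fun π => ∑ ω, π.1 ω * v ω) π a =
      ∑ ω, π.1 ω * θ.payoff a ω + d * ∑ ω, π.1 ω * v ω := by
  rw [θ.actionValue_eq d (θ.measurable_sum_belief v) (θ.abs_sum_belief_le v),
    sum_integral_linear_bayes]

/-- The value is at least that of always playing the same action. -/
theorem IsValueFunction.le_of_stationary {θ : SubjectiveModel E} {U : θ.Belief → ℝ}
    (hU : θ.IsValueFunction U) (a : A) (π : θ.Belief) :
    ∑ ω, π.1 ω * (θ.payoff a ω / (1 - E.δ)) ≤ U π := by
  obtain ⟨hUm, ⟨C, hC⟩, hG⟩ := hU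
  set v : θ.Ω → ℝ := fun ω => θ.payoff a ω / (1 - E.δ)
  have hδ : (1 - E.δ) ≠ 0 := by linarith [E.δ_lt_one]
  set K := (∑ ω, |v ω|) + C
  -- The linear function with coefficients `v` is a fixed point of the Bellman operator restricted
  -- to `a`, which never exceeds the full one; the initial gap `K` is discounted away.
  have key : ∀ n : ℕ, ∀ π : θ.Belief, ∑ ω, π.1 ω * v ω ≤ U π + E.δ ^ n * K := fun n => by
    induction n with
    | zero =>
      intro π
      have h1 := (abs_le.1 (θ.abs_sum_belief_le v π)).2
      have h2 := (abs_le.1 (hC π)).1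
      simp only [K, pow_zero, one_mul]
      linarith
    | succ n ih =>
      intro π
      have h := θ.actionValue_le_add E.δ_nonneg (θ.measurable_sum_belief v)
        (θ.abs_sum_belief_le v) hUm hC ih π a
      have hmax := (hG π).2 ⟨a, rfl⟩
      rw [actionValue_linear] at h
      have e : ∑ ω, π.1 ω * θ.payoff a ω = (1 - E.δ) * ∑ ω, π.1 ω * v ω := by
        rw [Finset.mul_sum]
        refine Finset.sum_congr rfl fun ω _ => ?_
        simp only [v]
        field_simp
      rw [pow_succ', mul_assoc]
      simp only at hmax
      linarith
  have ht : Tendsto (fun n : ℕ => U π + E.δ ^ n * K) atTop (𝓝 (U π)) := by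
    simpa using ((tendsto_pow_atTop_nhds_zero_of_lt_one E.δ_nonneg E.δ_lt_one).mul_const
      K).const_add (U π)
  exact ge_of_tendsto' ht fun n => key n π

/-- A dynamically optimal action that is uninformative at the belief is myopically optimal. -/
theorem IsValueFunction.mem_myopicOptimal {θ : SubjectiveModel E} {U : θ.Belief → ℝ}
    (hU : θ.IsValueFunction U) {π : θ.Belief} {a : A}
    (hq : ∀ ω, 0 < π.1 ω → E.q a =ᵐ[E.ν] θ.q a ω)
    (ha : ∀ b, θ.actionValue E.δ U π b ≤ θ.actionValue E.δ U π a) :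
    a ∈ θ.myopicOptimal π := by
  have hδ : (1 - E.δ) ≠ 0 := by linarith [E.δ_lt_one]
  have hle := hU.le_of_stationary a
  obtain ⟨hUm, ⟨C, hC⟩, hG⟩ := hU
  have hUa : U π = θ.actionValue E.δ U π a := by
    obtain ⟨⟨b, hb⟩, hmax⟩ := hG π
    exact le_antisymm (hb ▸ ha b) (hmax ⟨a, rfl⟩)
  -- All parameters in the support predict the same density after `a`, so the belief does not move
  -- and `U π` is the value of repeating `a` forever.
  have hbayes : ∀ᵐ y ∂E.ν, θ.bayes a y π = π := by
    have hall : ∀ᵐ y ∂E.ν, ∀ ω, 0 < π.1 ω → E.q a y = θ.q a ω y := by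
      rw [ae_all_iff]; intro ω
      by_cases hω : 0 < π.1 ω
      · filter_upwards [hq ω hω] with y hy _ using hy
      · exact ae_of_all _ fun y h => absurd h hω
    filter_upwards [hall] with y hy
    have hterm : ∀ ω, π.1 ω * θ.q a ω y = π.1 ω * E.q a y := fun ω => by
      rcases (π.2.1 ω).eq_or_lt with h | h
      · have h0 : π.1 ω = 0 := h.symm
        rw [h0, zero_mul, zero_mul]
      · rw [hy ω h]
    refine Subtype.ext (funext fun ω => ?_)
    change π.1 ω * θ.q a ω y / ∑ ω', π.1 ω' * θ.q a ω' y = π.1 ω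
    simp_rw [hterm]
    have : ∑ ω, π.1 ω = 1 := π.2.2
    rw [← Finset.sum_mul, this, one_mul, mul_div_cancel_right₀ _ (E.q_pos a y).ne']
  have hsum : ∑ ω, π.1 ω = 1 := π.2.2
  have hcont : ∑ ω, π.1 ω * ∫ y, U (θ.bayes a y π) ∂θ.Q a ω = U π := by
    have : ∀ ω, ∫ y, U (θ.bayes a y π) ∂θ.Q a ω = U π := fun ω => by
      have hae : ∀ᵐ y ∂θ.Q a ω, U (θ.bayes a y π) = U π := by
        filter_upwards [(withDensity_absolutelyContinuous E.ν _ : θ.Q a ω ≪ E.ν) hbayes] with y hy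
        rw [hy]
      rw [integral_congr_ae hae]; simp
    simp_rw [this]
    rw [← Finset.sum_mul, hsum, one_mul]
  have h1 : U π = ∑ ω, π.1 ω * θ.payoff a ω + E.δ * U π := by
    conv_lhs => rw [hUa, θ.actionValue_eq E.δ hUm hC, hcont]
  have h2 : ∑ ω, π.1 ω * (θ.payoff a ω / (1 - E.δ)) = U π := by
    simp_rw [← mul_div_assoc]
    rw [← Finset.sum_div, div_eq_iff hδ]
    linarith
  intro b
  rw [actionValue_zero, actionValue_zero]
  -- After a deviation to `b`, repeating `a` already secures an expected continuation of `U π`,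
  -- since beliefs are a martingale. As `b` is not dynamically better, its flow payoff cannot exceed
  -- that of `a`.
  have h3 := θ.actionValue_le_add E.δ_nonneg (θ.measurable_sum_belief _)
    (θ.abs_sum_belief_le fun ω => θ.payoff a ω / (1 - E.δ)) hUm hC (ε := 0)
    (fun π => by simpa using hle π) π b
  rw [actionValue_linear, h2] at h3
  linarith [ha b]

end SubjectiveModel

theorem exists_supp_eq {A : Type*} [Fintype A] {B : Set A} (hB : B.Nonempty) :
    ∃ σ : stdSimplex ℝ A, supp σ = B := by
  classical
  obtain ⟨b, hb⟩ := hB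
  have hc : 0 < (B.toFinset.card : ℝ) :=
    Nat.cast_pos.2 (Finset.card_pos.2 ⟨b, Set.mem_toFinset.2 hb⟩)
  refine ⟨⟨fun a => if a ∈ B.toFinset then (B.toFinset.card : ℝ)⁻¹ else 0, fun a => ?_, ?_⟩, ?_⟩
  · dsimp only
    split_ifs <;> positivity
  · rw [Finset.sum_ite_mem, Finset.univ_inter, Finset.sum_const, nsmul_eq_mul,
      mul_inv_cancel₀ hc.ne']
  · ext a
    change (0 : ℝ) < (if a ∈ B.toFinset then (B.toFinset.card : ℝ)⁻¹ else 0) ↔ a ∈ B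
    by_cases ha : a ∈ B
    · simp only [Set.mem_toFinset, ha, if_true, iff_true]; positivity
    · simp [ha]

/-! ### Limit beliefs and the equilibrium they support -/

namespace SubjectiveModel

variable {A Y : Type*} [MeasurableSpace Y] {E : Environment A Y}

/-- Positivity of the true density makes null sets of `E.Q a` null for `E.ν`. -/
theorem ae_eq_of_ratio_ae_eq_one {θ : SubjectiveModel E} {ω : θ.Ω} {a : A}
    (h : θ.ratio ω a =ᵐ[E.Q a] 1) : E.q a =ᵐ[E.ν] θ.q a ω := by
  have h' := (ae_withDensity_iff (E.measurable_q a).ennreal_ofReal).1 h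
  filter_upwards [h'] with y hy
  have := hy (ENNReal.ofReal_pos.2 (E.q_pos a y)).ne'
  rw [ratio, Pi.one_apply, div_eq_one_iff_eq (E.q_pos a y).ne'] at this
  exact this.symm

theorem weightedKL_eq_zero [Fintype A] {θ : SubjectiveModel E} {σ : stdSimplex ℝ A} {ω : θ.Ω}
    (h : ∀ a ∈ supp σ, E.q a =ᵐ[E.ν] θ.q a ω) : θ.weightedKL σ ω = 0 := by
  refine Finset.sum_eq_zero fun a _ => ?_
  by_cases ha : a ∈ supp σ
  · have : θ.Q a ω = E.Q a := by
      refine withDensity_congr_ae ?_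
      filter_upwards [h a ha] with y hy
      rw [hy]
    rw [this, InformationTheory.klDiv_self, mul_zero]
  · rw [ENNReal.ofReal_of_nonpos (not_lt.1 ha), zero_mul]

/-- If the posterior converges along some path and the limit belief is correct about the actions
played infinitely often, then these actions support a self-confirming equilibrium. -/
theorem IsOptimalPolicy.isSelfConfirming [Fintype A] [Nonempty A] {θ : SubjectiveModel E}
    {pol : θ.Belief → A} (hpol : θ.IsOptimalPolicy pol) {p : ℕ → θ.Belief} {μ : θ.Belief}
    (hp : Tendsto p atTop (𝓝 μ)) {σ : stdSimplex ℝ A}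
    (hσ : ∀ a ∈ supp σ, ∃ᶠ t in atTop, pol (p t) = a)
    (hq : ∀ ω, 0 < μ.1 ω → ∀ a ∈ supp σ, E.q a =ᵐ[E.ν] θ.q a ω) :
    θ.IsSelfConfirming σ := by
  obtain ⟨-, U, hU, hopt⟩ := hpol
  obtain ⟨C, hC⟩ := hU.2.1
  have hcont := fun a => θ.continuous_actionValue E.δ hU.continuous hC a
  have hmin : ∀ ω, 0 < μ.1 ω → ω ∈ θ.klMinimizers σ := fun ω hω ω' => by
    rw [weightedKL_eq_zero (hq ω hω)]
    exact bot_le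
  have hmy : supp σ ⊆ θ.myopicOptimal μ := fun a ha => by
    refine hU.mem_myopicOptimal (fun ω hω => hq ω hω a ha) fun b => ?_
    -- Weak optimality of `a` holds at infinitely many beliefs of the sequence and is a closed
    -- condition, so it survives at the limit.
    have h1 : Tendsto (fun t => θ.actionValue E.δ U (p t) a - θ.actionValue E.δ U (p t) b) atTop
        (𝓝 (θ.actionValue E.δ U μ a - θ.actionValue E.δ U μ b)) :=
      (((hcont a).tendsto μ).comp hp).sub (((hcont b).tendsto μ).comp hp)
    have h2 : ∃ᶠ t in atTop, θ.actionValue E.δ U (p t) a - θ.actionValue E.δ U (p t) b ∈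
        Set.Ici (0 : ℝ) := (hσ a ha).mono fun t ht => sub_nonneg.2 (ht ▸ hopt (p t) b)
    exact sub_nonneg.1 (isClosed_Ici.mem_of_frequently_of_tendsto h2 h1)
  exact ⟨⟨μ, hmin, hmy⟩, μ, hmin, hmy, hq⟩

theorem LikelihoodSurvives.exists_equilibrium [Fintype A] [Nonempty A] {θ : SubjectiveModel E}
    {π : θ.Belief} {pol : θ.Belief → A} (hsurv : θ.LikelihoodSurvives π pol)
    (hπ : θ.FullSupport π) (hpol : θ.IsOptimalPolicy pol) :
    ∃ σ : stdSimplex ℝ A, θ.IsSelfConfirming σ ∧ θ.IsPAbsorbing σ := by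
  have hf := θ.measurableRule_dogmatic π hpol.1
  set f := θ.dogmatic π pol with hfdef
  set S := {s | ∃ c > 0, ∃ T, ∀ t ≥ T, c ≤ θ.relLikelihood π (historyOf f s t)} with hS
  set io : (A × ℕ → Y) → Set A := fun s => {a | ∃ᶠ t in atTop, f (historyOf f s t) = a}
  have hev : ∀ s, ∀ᶠ t in atTop, f (historyOf f s t) ∈ io s := fun s => by
    have h : ∀ᶠ t in atTop, ∀ a, a ∉ io s → f (historyOf f s t) ≠ a := by
      rw [eventually_all]; intro a
      by_cases ha : a ∈ io s
      · exact Eventually.of_forall fun t h => absurd ha h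
      · filter_upwards [not_frequently.1 ha] with t ht _ using ht
    filter_upwards [h] with t ht
    by_contra hcon
    exact ht _ hcon rfl
  -- The equilibrium may not depend on the path, so one of the finitely many recurrent sets is
  -- fixed.
  obtain ⟨B, hB⟩ : ∃ B : Set A, 0 < E.P (S ∩ {s | io s = B}) := by
    by_contra! hcon
    refine hsurv.ne' (measure_mono_null ?_ (measure_iUnion_null fun B =>
      le_antisymm (hcon B) bot_le))
    exact fun s hs => Set.mem_iUnion.2 ⟨io s, hs, rfl⟩
  have h1 : ∀ᵐ s ∂E.P, ∀ ω, ∃ l,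
      Tendsto (fun t => pathProd (θ.ratio ω) (historyOf f s t)) atTop (𝓝 l) :=
    ae_all_iff.2 fun ω => ae_exists_tendsto_of_nonneg (martingale_pathProd (θ.meanOne_ratio ω) hf)
      fun t s => pathProd_nonneg (fun a y => (θ.ratio_pos ω a y).le) _
  have h2 : ∀ᵐ s ∂E.P, ∀ ω a, ¬ (θ.ratio ω a =ᵐ[E.Q a] 1) →
      (∃ᶠ t in atTop, f (historyOf f s t) = a) →
      Tendsto (fun t => pathProd (θ.ratio ω) (historyOf f s t)) atTop (𝓝 0) :=
    ae_all_iff.2 fun ω => ae_tendsto_pathProd_zero (θ.meanOne_ratio ω) (θ.ratio_pos ω) hf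
  -- Being self-confirming does not involve the path, so one typical path in the event is enough;
  -- the whole event is needed again only for absorption.
  obtain ⟨s, ⟨⟨c, hc, T, hT⟩, hio⟩, hlim, hzero⟩ : ∃ s ∈ S ∩ {s | io s = B}, (∀ ω, ∃ l,
      Tendsto (fun t => pathProd (θ.ratio ω) (historyOf f s t)) atTop (𝓝 l)) ∧
      ∀ ω a, ¬ (θ.ratio ω a =ᵐ[E.Q a] 1) → (∃ᶠ t in atTop, f (historyOf f s t) = a) →
      Tendsto (fun t => pathProd (θ.ratio ω) (historyOf f s t)) atTop (𝓝 0) := by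
    by_contra! hcon
    refine hB.ne' (measure_eq_zero_iff_ae_notMem.2 ?_)
    filter_upwards [h1, h2] with s h1 h2 hs
    obtain ⟨ω, a, hωa, hio, hnot⟩ := hcon s hs h1
    exact hnot (h2 ω a hωa hio)
  choose ℓ hℓ using hlim
  have hL : Tendsto (fun t => θ.relLikelihood π (historyOf f s t)) atTop
      (𝓝 (∑ ω, π.1 ω * ℓ ω)) := tendsto_finsetSum _ fun ω _ => (hℓ ω).const_mul _
  set L := ∑ ω, π.1 ω * ℓ ω
  have hL0 : 0 < L := hc.trans_le (ge_of_tendsto hL (eventually_atTop.2 ⟨T, hT⟩))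
  have hℓ0 : ∀ ω, 0 ≤ ℓ ω := fun ω =>
    ge_of_tendsto' (hℓ ω) fun t => pathProd_nonneg (fun a y => (θ.ratio_pos ω a y).le) _
  set μ : θ.Belief := ⟨fun ω => π.1 ω * ℓ ω / L,
    fun ω => div_nonneg (mul_nonneg (π.2.1 ω) (hℓ0 ω)) hL0.le,
    by rw [← Finset.sum_div]; exact div_self hL0.ne'⟩ with hμ
  have hpost : Tendsto (fun t => θ.posterior π (historyOf f s t)) atTop (𝓝 μ) := by
    refine tendsto_subtype_rng.2 (tendsto_pi_nhds.2 fun ω => ?_)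
    simp only [posterior_apply]
    exact ((hℓ ω).const_mul _).div hL hL0.ne'
  obtain ⟨σ, hσ⟩ : ∃ σ : stdSimplex ℝ A, supp σ = B := by
    obtain ⟨t, ht⟩ := (hev s).exists
    exact exists_supp_eq ⟨_, hio ▸ ht⟩
  have hsc : θ.IsSelfConfirming σ := by
    refine hpol.isSelfConfirming hpost (fun a ha => ?_) fun ω hω a ha => ?_
    · rw [hσ, ← (hio : io s = B)] at ha
      exact ha
    · rw [hσ, ← (hio : io s = B)] at ha
      refine ae_eq_of_ratio_ae_eq_one ?_
      -- A parameter with positive limit weight has a nonzero limit product, which a wrong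
      -- prediction about a recurring action would rule out.
      by_contra hne
      have h0 : ℓ ω = 0 := tendsto_nhds_unique (hℓ ω) (hzero ω a hne ha)
      simp [hμ, h0] at hω
  refine ⟨σ, hsc, hsc.1, π, pol, hπ, hpol, ?_⟩
  -- Each path of the event stays in `B` from some period on; countably many candidate periods cover
  -- it, so one of them has positive probability.
  by_contra! hcon
  refine hB.ne' (measure_mono_null ?_ (measure_iUnion_null fun T =>
    le_antisymm (hcon T) bot_le))
  rintro s ⟨-, hs⟩
  obtain ⟨T, hT⟩ := eventually_atTop.1 (hev s)
  refine Set.mem_iUnion.2 ⟨T, fun t ht => ?_⟩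
  rw [hσ, ← (hs : io s = B)]
  exact hT t ht

end SubjectiveModel

end ModelSwitching

end

/-! ### The equivalence -/

theorem theorem1 {A Y : Type*} [Fintype A] [Nonempty A] [MeasurableSpace Y]
    [StandardBorelSpace Y] (E : ModelSwitching.Environment A Y) (α : ℝ) (hα : 1 < α)
    (θ : ModelSwitching.SubjectiveModel E) :
    (ModelSwitching.SubjectiveModel.IsGloballyRobust α θ ↔
      ∃ σ : stdSimplex ℝ A, θ.IsSelfConfirming σ ∧ θ.IsPAbsorbing σ) ∧
    ((∃ σ : stdSimplex ℝ A, θ.IsSelfConfirming σ ∧ θ.IsPAbsorbing σ) →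
      ∃ (π₀ : θ.Belief) (pol : θ.Belief → A), θ.FullSupport π₀ ∧ θ.IsOptimalPolicy pol ∧
        ∀ (θc : ModelSwitching.SubjectiveModel E) (πc : θc.Belief) (polc : θc.Belief → A),
          θc.FullSupport πc → θc.IsOptimalPolicy polc →
            ModelSwitching.SubjectiveModel.NeverSwitches α θ θc π₀ πc pol polc) := by
  have hnever : (∃ σ : stdSimplex ℝ A, θ.IsSelfConfirming σ ∧ θ.IsPAbsorbing σ) →
      ∃ (π₀ : θ.Belief) (pol : θ.Belief → A), θ.FullSupport π₀ ∧ θ.IsOptimalPolicy pol ∧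
        ∀ (θc : ModelSwitching.SubjectiveModel E) (πc : θc.Belief) (polc : θc.Belief → A),
          θc.FullSupport πc → θc.IsOptimalPolicy polc →
            ModelSwitching.SubjectiveModel.NeverSwitches α θ θc π₀ πc pol polc := by
    -- The absorbing policy is kept; only the prior is replaced, by a posterior along the absorbing
    -- run.
    rintro ⟨σ, hσ, -, π, pol, hπ, hpol, T, hT⟩
    obtain ⟨π₁, hπ₁, h⟩ :=
      (hσ.likelihoodSurvives hπ hT).exists_neverSwitches hπ hpol.1 hα
    exact ⟨π₁, pol, hπ₁, hpol, fun θc πc polc _ _ => h θc πc polc⟩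
  refine ⟨⟨?_, fun h => ?_⟩, hnever⟩
  · rintro ⟨π, pol, hπ, hpol, h⟩
    obtain ⟨polc, hpolc⟩ := ModelSwitching.SubjectiveModel.exists_isOptimalPolicy_trueModel (E := E)
    have hπc : ∃ πc : E.trueModel.Belief, E.trueModel.FullSupport πc :=
      ⟨⟨fun _ => 1, fun _ => zero_le_one, by simp⟩, fun _ => zero_lt_one⟩
    obtain ⟨πc, hπc⟩ := hπc
    obtain ⟨π₁, hπ₁, hs⟩ :=
      (h E.trueModel πc polc hπc hpolc).likelihoodSurvives hα hπ hpol.1 hpolc.1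
    exact hs.exists_equilibrium hπ₁ hpol
  · obtain ⟨π, pol, hπ, hpol, hn⟩ := hnever h
    exact ⟨π, pol, hπ, hpol, fun θc πc polc h1 h2 => (hn θc πc polc h1 h2).persistsAgainst⟩
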